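/- For a Young diagram $\lambda$ with $n$ boxes and $\pi\in S_l$, let $$\Sigma^\lambda(\pi)=n(n-1)\cdots(n-l+1)\,\frac{\operatorname{Tr}\rho^\lambda(\pi)}{\operatorname{Tr}\rho^\lambda(e)}$$ be the normalized character, where $\rho^\lambda$ is the irreducible representation of $S_n$ of shape $\lambda$ and $\pi$ is regarded as an element of $S_n$ by adding fixed points ($\Sigma^\lambda(\pi)=0$ if $l>n$). Let $T_\lambda=(t_{ij})$ be the random matrix with independent entries such that $t_{ij}$ is a centered complex Gaussian variable with $\mathbb{E}|t_{ij}|^2=1$, $\mathbb{E}\,t_{ij}^2=0$ if $\lambda$ has a box in column $i$ and row $j$, and $t_{ij}=0$ otherwise. For $\mathbf p=(p_1,\dots,p_m)$, $\mathbf q=(q_1,\dots,q_m)$ positive integers with $q_1\ge\dots\ge q_m$, let $\mathbf p\times\mathbf q$ be the multirectangular Young diagram which has $p_1$ rows of length $q_1$, then $p_2$ rows of length $q_2$, and so on. **Theorem.** Fix $m,l\ge 0$ and $\pi\in S_l$, and let $k_1,\dots,k_r$ be the lengths of all cycles of $\pi$ (fixed points included). There is a unique polynomial $S_\pi\in\mathbb{C}[p_1,\dots,p_m,q_1,\dots,q_m]$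 whose value is $\Sigma^{\mathbf p\times\mathbf q}(\pi)$ for every multirectangular Young diagram $\mathbf p\times\mathbf q$ as above. There is a unique polynomial $M_\pi\in\mathbb{C}[p_1,\dots,p_m,q_1,\dots,q_m]$ whose value is $$\mathbb{E}\big(\operatorname{Tr}(T_\lambda T_\lambda^\star)^{k_1}\cdots\operatorname{Tr}(T_\lambda T_\lambda^\star)^{k_r}\big),\qquad \lambda=\mathbf p\times\mathbf q,$$ (this expectation exists) for every such $\mathbf p\times\mathbf q$. These polynomials define both quantities for arbitrary $\mathbf p,\mathbf q\in\mathbb{C}^m$ (formal Young diagrams $\mathbf p\times\mathbf q$), and $$S_\pi(\mathbf p,\mathbf q)=(-1)^l\,M_\pi(\mathbf p,-\mathbf q)\qquad\text{for all }\mathbf p,\mathbf q\in\mathbb{C}^m,$$ that is, $\Sigma^{\mathbf p\times\mathbf q}(\pi)=(-1)^l\,\mathbb{E}\big(\prod_{i}\operatorname{Tr}(T_{\mathbf p\times(-\mathbf q)}T_{\mathbf p\times(-\mathbf q)}^\star)^{k_i}\big)$ for every formal Young diagram $\mathbf p\times\mathbf q$. -/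

import Mathlib

open MeasureTheory ProbabilityTheory Matrix

noncomputable section

/-! ### Young diagrams and normalized characters

In a `YoungDiagram` the cell `(i, j)` lies in row `i` and column `j` (both counted from `0`). -/

/-- Permutations of the boxes of `lam`. -/
abbrev BoxPerm (lam : YoungDiagram) : Type := Equiv.Perm lam.cells

/-- The complex group algebra of the group of permutations of the boxes of `lam`. -/
abbrev BoxAlgebra (lam : YoungDiagram) : Type := MonoidAlgebra ℂ (BoxPerm lam)

open Classical in
/-- `a_lam`: the sum of all permutations of the boxes which preserve each row. -/
def rowSymmetrizer (lam : YoungDiagram) : BoxAlgebra lam :=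
  ∑ σ : BoxPerm lam with ∀ x, (σ x).1.1 = x.1.1, MonoidAlgebra.single σ 1

open Classical in
/-- `b_lam`: the signed sum of all permutations of the boxes which preserve each column. -/
def columnAntisymmetrizer (lam : YoungDiagram) : BoxAlgebra lam :=
  ∑ σ : BoxPerm lam with ∀ x, (σ x).1.2 = x.1.2,
    MonoidAlgebra.single σ ((Equiv.Perm.sign σ : ℤ) : ℂ)

/-- The space of the irreducible representation of shape `lam`: the left ideal of the group algebra
generated by the Young symmetrizer `b_lam * a_lam`. -/
abbrev spechtSpace (lam : YoungDiagram) : Submodule (BoxAlgebra lam) (BoxAlgebra lam) :=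
  Submodule.span (BoxAlgebra lam) {columnAntisymmetrizer lam * rowSymmetrizer lam}

/-- The irreducible representation of shape `lam`: left multiplication on `spechtSpace lam`. -/
def spechtRep (lam : YoungDiagram) : Representation ℂ (BoxPerm lam) (spechtSpace lam) :=
  (Algebra.lsmul ℂ ℂ (spechtSpace lam) :
      BoxAlgebra lam →ₐ[ℂ] Module.End ℂ (spechtSpace lam)).toMonoidHom.comp
    (MonoidAlgebra.of ℂ (BoxPerm lam))

/-- A permutation `π ∈ S_l` regarded as an element of `S_n` for `n ≥ l` (the additional points are
fixed) and then, through an enumeration of the boxes, as a permutation of the `n` boxes of `lam`.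
Its conjugacy class does not depend on the enumeration. -/
def toBoxPerm (lam : YoungDiagram) {l : ℕ} (h : l ≤ lam.card) (π : Equiv.Perm (Fin l)) :
    BoxPerm lam :=
  lam.cells.equivFin.symm.permCongr (π.viaEmbedding (Fin.castLEEmb h))

/-- The normalized character `Σ^lam(π) = (n)_l Tr ρ(π) / Tr ρ(e)` for `π ∈ S_l`, where `n` is the
number of boxes of `lam` and `(n)_l = n (n - 1) ⋯ (n - l + 1)`. For `l > n` the falling factorial
`(n)_l` vanishes and the value is `0`. -/
def normalizedCharacter (lam : YoungDiagram) {l : ℕ} (π : Equiv.Perm (Fin l)) : ℂ :=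
  if h : l ≤ lam.card then
    (lam.card.descFactorial l : ℂ) *
      ((spechtRep lam).character (toBoxPerm lam h π) / (spechtRep lam).character 1)
  else 0

/-! ### Multirectangular diagrams -/

/-- The list of row lengths `q 0, …, q 0, q 1, …, q 1, …`, where `q i` is repeated `p i` times. -/
def multirectList {m : ℕ} (p q : Fin m → ℕ) : List ℕ :=
  (List.ofFn fun i => List.replicate (p i) (q i)).flatten

theorem multirectList_sortedGE {m : ℕ} (p : Fin m → ℕ) {q : Fin m → ℕ} (hq : Antitone q) :
    (multirectList p q).SortedGE := by
  rw [List.sortedGE_iff_pairwise, multirectList, List.pairwise_flatten]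
  refine ⟨?_, ?_⟩
  · intro L hL
    obtain ⟨i, rfl⟩ := (List.mem_ofFn' _ _).1 hL
    rw [List.pairwise_replicate]
    exact Or.inr le_rfl
  · rw [List.pairwise_ofFn]
    intro i j hij x hx y hy
    rw [List.eq_of_mem_replicate hx, List.eq_of_mem_replicate hy]
    exact hq hij.le

/-- The multirectangular Young diagram `p × q`. -/
def multirect {m : ℕ} (p q : Fin m → ℕ) (hq : Antitone q) : YoungDiagram :=
  YoungDiagram.ofRowLens (multirectList p q) (multirectList_sortedGE p hq)

/-! ### The Gaussian random matrix of a Young diagram -/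

/-- The law of a standard complex centered Gaussian variable `t`: the real and imaginary parts are
independent centered real Gaussians of variance `1/2`, so `E t = 0`, `E |t|² = 1`, `E t² = 0`. -/
def stdComplexGaussian : Measure ℂ :=
  ((gaussianReal 0 (1 / 2)).prod (gaussianReal 0 (1 / 2))).map
    fun z : ℝ × ℝ => (⟨z.1, z.2⟩ : ℂ)

/-- The joint law of the entries of `T_lam` at the boxes of `lam`: independent standard complex
Gaussians. -/
def entryLaw (lam : YoungDiagram) : Measure (lam.cells → ℂ) :=
  Measure.pi fun _ => stdComplexGaussian

/-- A common bound for the number of columns and the number of rows of `lam`. -/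
def diagramSize (lam : YoungDiagram) : ℕ := max (lam.rowLen 0) (lam.colLen 0)

/-- The matrix `T_lam` as a function of the entries `t` at the boxes of `lam`, truncated to a
square matrix which contains all boxes. The entry in place `(i, j)` belongs to the box in column
`i` and row `j` of `lam`; it is `0` if there is no such box. -/
def bandMatrix (lam : YoungDiagram) (t : lam.cells → ℂ) :
    Matrix (Fin (diagramSize lam)) (Fin (diagramSize lam)) ℂ :=
  Matrix.of fun i j =>
    if h : ((j : ℕ), (i : ℕ)) ∈ lam.cells then t ⟨((j : ℕ), (i : ℕ)), h⟩ else 0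

/-- `Tr (T T*)^{k_1} ⋯ Tr (T T*)^{k_r}`, where `k_1, …, k_r` are the lengths of all cycles of `π`
(fixed points are cycles of length `1`). -/
def traceProduct (lam : YoungDiagram) {l : ℕ} (π : Equiv.Perm (Fin l)) (t : lam.cells → ℂ) : ℂ :=
  (π.partition.parts.map fun k => ((bandMatrix lam t * (bandMatrix lam t)ᴴ) ^ k).trace).prod

/-! ### Formal diagrams

Polynomials in the `2 m` variables `p_1, …, p_m, q_1, …, q_m`; the left summand of
`Fin m ⊕ Fin m` indexes the variables `p`, the right one the variables `q`. -/

/-- `S(p, q) = Σ^{p × q}(π)` for every multirectangular Young diagram `p × q` with `m` blocks. -/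
def IsCharacterPolynomial {m l : ℕ} (π : Equiv.Perm (Fin l))
    (S : MvPolynomial (Fin m ⊕ Fin m) ℂ) : Prop :=
  ∀ (p q : Fin m → ℕ) (hq : Antitone q), (∀ i, 0 < p i) → (∀ i, 0 < q i) →
    MvPolynomial.eval (Sum.elim (fun i => (p i : ℂ)) (fun i => (q i : ℂ))) S =
      normalizedCharacter (multirect p q hq) π

/-- `M(p, q) = E (Tr (T T*)^{k_1} ⋯ Tr (T T*)^{k_r})` with `T = T_{p × q}` for every
multirectangular Young diagram `p × q` with `m` blocks, where the expectation exists. -/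
def IsMomentPolynomial {m l : ℕ} (π : Equiv.Perm (Fin l))
    (M : MvPolynomial (Fin m ⊕ Fin m) ℂ) : Prop :=
  ∀ (p q : Fin m → ℕ) (hq : Antitone q), (∀ i, 0 < p i) → (∀ i, 0 < q i) →
    Integrable (traceProduct (multirect p q hq) π) (entryLaw (multirect p q hq)) ∧
      MvPolynomial.eval (Sum.elim (fun i => (p i : ℂ)) (fun i => (q i : ℂ))) M =
        ∫ t, traceProduct (multirect p q hq) π t ∂(entryLaw (multirect p q hq))

end

/-! Both quantities are sums over `σ` in `S_l` of the same numbers, weighted differently. Let `N(σ,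
τ)` count the maps from `Fin l` to the boxes whose columns are constant on the cycles of `σ` and
whose rows are constant on the cycles of `τ = σ⁻¹ * π⁻¹`. The character is the sum of `sign σ * N(σ,
τ)` (`normalizedCharacter_eq_sum`) and the Gaussian moment is the sum of `N(σ, τ)`
(`integral_traceProduct`).

On `p × q` the count `N(σ, τ)` is a polynomial, homogeneous in `q` of degree the number of cycles of
`σ` (`card_isCompatible`). Hence `q ↦ -q` multiplies it by `(-1) ^ #cycles`, and `(-1) ^ l * (-1) ^
#cycles` is the sign of `σ`. The values on genuine diagrams determine a polynomial
(`MvPolynomial.eq_of_eval_multirect`), which gives uniqueness.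

The character formula comes from the Young symmetrizer `y`: since `y * y = α • y`, the trace of `x ↦
g * x * y` on the group algebra is `α` times the character, and `α` cancels in the normalized
quotient. The moment formula is Wick's formula applied to the expansion of the traces over closed
paths. -/

noncomputable section

/-! ### Row- and column-preserving permutations of the boxes -/

/-- The permutation `σ` preserves each row of `lam`. -/
def PreservesRows {lam : YoungDiagram} (σ : BoxPerm lam) : Prop := ∀ x, (σ x).1.1 = x.1.1

/-- The permutation `σ` preserves each column of `lam`. -/
def PreservesCols {lam : YoungDiagram} (σ : BoxPerm lam) : Prop := ∀ x, (σ x).1.2 = x.1.2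

namespace PreservesRows

variable {lam : YoungDiagram} {σ τ : BoxPerm lam}

theorem mul (hσ : PreservesRows σ) (hτ : PreservesRows τ) : PreservesRows (σ * τ) := fun x => by
  rw [Equiv.Perm.mul_apply, hσ, hτ]

theorem inv (hσ : PreservesRows σ) : PreservesRows σ⁻¹ := fun x => by
  rw [← hσ, ← Equiv.Perm.mul_apply, mul_inv_cancel, Equiv.Perm.one_apply]

end PreservesRows

namespace PreservesCols

variable {lam : YoungDiagram} {σ τ : BoxPerm lam}

theorem mul (hσ : PreservesCols σ) (hτ : PreservesCols τ) : PreservesCols (σ * τ) := fun x => by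
  rw [Equiv.Perm.mul_apply, hσ, hτ]

theorem inv (hσ : PreservesCols σ) : PreservesCols σ⁻¹ := fun x => by
  rw [← hσ, ← Equiv.Perm.mul_apply, mul_inv_cancel, Equiv.Perm.one_apply]

end PreservesCols

/-! ### The Young symmetrizer is idempotent up to a scalar. -/

section YoungSymmetrizer

variable {lam : YoungDiagram}

theorem YoungDiagram.cells_ext {x y : lam.cells} (h1 : x.1.1 = y.1.1) (h2 : x.1.2 = y.1.2) :
    x = y := Subtype.ext (Prod.ext h1 h2)

theorem card_row_lt (i k : ℕ) :
    (Finset.univ.filter fun x : lam.cells => x.1.1 = i ∧ x.1.2 < k).card =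
      min (lam.rowLen i) k := by
  rw [← Finset.card_range (min (lam.rowLen i) k)]
  refine Finset.card_bij (fun x _ => x.1.2) ?_ ?_ ?_
  · rintro ⟨⟨a, b⟩, hx⟩ h
    simp only [Finset.mem_filter, Finset.mem_univ, true_and] at h
    obtain ⟨rfl, hb⟩ := h
    have := YoungDiagram.mem_iff_lt_rowLen.1 ((YoungDiagram.mem_cells _).1 hx)
    simp [this, hb]
  · intro x hx y hy h
    simp only [Finset.mem_filter, Finset.mem_univ, true_and] at hx hy
    exact YoungDiagram.cells_ext (hx.1.trans hy.1.symm) h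
  · intro b hb
    rw [Finset.mem_range, lt_min_iff] at hb
    refine ⟨⟨(i, b), (YoungDiagram.mem_cells _).2 (YoungDiagram.mem_iff_lt_rowLen.2 hb.1)⟩, ?_, rfl⟩
    simp [hb.2]

/-- If `g` moves no two boxes of a row into the same column, then the row of `x` is long enough to
contain a box in the column of `g x`. -/
theorem mem_of_separates (g : BoxPerm lam)
    (hg : ∀ x y : lam.cells, x.1.1 = y.1.1 → (g x).1.2 = (g y).1.2 → x = y) (x : lam.cells) :
    (x.1.1, (g x).1.2) ∈ lam.cells := by
  classical
  -- Counting argument: in each row `i` at most `min (rowLen i) k` boxes are sent by `g` to the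
  -- first `k` columns. Summed over `i` this bound is attained, `g` being bijective, so it is
  -- attained in every row; in the row of `x` that means all boxes.
  set k := lam.rowLen x.1.1 with hk
  let F : ℕ → Finset lam.cells := fun i => Finset.univ.filter fun y => y.1.1 = i ∧ (g y).1.2 < k
  let E : ℕ → Finset lam.cells := fun i => Finset.univ.filter fun y => y.1.1 = i ∧ y.1.2 < k
  let R : Finset ℕ := Finset.univ.image fun y : lam.cells => y.1.1
  have hrow : ∀ i, (Finset.univ.filter fun y : lam.cells => y.1.1 = i).card = lam.rowLen i := by
    intro i
    rw [← min_self (lam.rowLen i), ← card_row_lt]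
    congr 1
    ext y
    simp only [Finset.mem_filter, Finset.mem_univ, true_and, iff_self_and]
    rintro rfl
    exact YoungDiagram.mem_iff_lt_rowLen.1 ((YoungDiagram.mem_cells _).1 y.2)
  have hle : ∀ i, (F i).card ≤ (E i).card := by
    intro i
    rw [card_row_lt, le_min_iff, ← hrow i]
    refine ⟨Finset.card_le_card fun y => ?_, ?_⟩
    · simp only [F, Finset.mem_filter, Finset.mem_univ, true_and]
      exact fun h => h.1
    · rw [← Finset.card_range k]
      refine Finset.card_le_card_of_injOn (fun y => (g y).1.2) ?_ ?_
      · intro y hy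
        simpa using (Finset.mem_filter.1 hy).2.2
      · intro y hy z hz h
        exact hg y z ((Finset.mem_filter.1 hy).2.1.trans (Finset.mem_filter.1 hz).2.1.symm) h
  have hsum : ∑ i ∈ R, (F i).card = ∑ i ∈ R, (E i).card := by
    have key : ∀ P : lam.cells → Prop, [DecidablePred P] →
        ∑ i ∈ R, (Finset.univ.filter fun y : lam.cells => y.1.1 = i ∧ P y).card =
          (Finset.univ.filter P).card := by
      intro P _
      rw [Finset.card_eq_sum_card_fiberwise (f := fun y : lam.cells => y.1.1) (t := R)]
      · refine Finset.sum_congr rfl fun i _ => ?_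
        rw [Finset.filter_filter]
        simp_rw [and_comm]
      · intro y _
        exact Finset.mem_image_of_mem _ (Finset.mem_univ y)
    rw [key, key]
    refine Finset.card_bij (fun y _ => g y) ?_ ?_ ?_
    · intro y hy
      simpa using hy
    · intro y _ z _ h
      exact g.injective h
    · intro y hy
      exact ⟨g⁻¹ y, by simpa using hy, by simp⟩
  have heq := (Finset.sum_eq_sum_iff_of_le fun i _ => hle i).1 hsum x.1.1
    (Finset.mem_image_of_mem _ (Finset.mem_univ x))
  rw [card_row_lt, ← hk, min_self, hk, ← hrow] at heq
  have hsub : F x.1.1 ⊆ Finset.univ.filter fun y : lam.cells => y.1.1 = x.1.1 := fun y => by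
    simp only [F, Finset.mem_filter, Finset.mem_univ, true_and]
    exact fun h => h.1
  have hx : x ∈ F x.1.1 := by
    rw [Finset.eq_of_subset_of_card_le hsub heq.ge]
    simp
  exact (YoungDiagram.mem_cells _).2
    (YoungDiagram.mem_iff_lt_rowLen.2 (Finset.mem_filter.1 hx).2.2)

/-- A permutation which moves no two boxes of a row into the same column is the product of a
column-preserving and a row-preserving permutation. -/
theorem exists_eq_mul_of_separates (g : BoxPerm lam)
    (hg : ∀ x y : lam.cells, x.1.1 = y.1.1 → (g x).1.2 = (g y).1.2 → x = y) :
    ∃ σ τ : BoxPerm lam, PreservesCols σ ∧ PreservesRows τ ∧ g = σ * τ := by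
  -- The row factor moves each box inside its row to the column where `g` sends it; what remains of
  -- `g` only changes rows.
  let f : lam.cells → lam.cells := fun x => ⟨(x.1.1, (g x).1.2), mem_of_separates g hg x⟩
  have hf : Function.Injective f := fun x y h => by
    have h' := congrArg Subtype.val h
    exact hg x y (Prod.mk.inj h').1 (Prod.mk.inj h').2
  let τ : BoxPerm lam := Equiv.ofBijective f (Finite.injective_iff_bijective.1 hf)
  refine ⟨g * τ⁻¹, τ, fun x => ?_, fun x => rfl, by simp⟩
  obtain ⟨y, rfl⟩ := τ.surjective x
  rw [← Equiv.Perm.mul_apply, inv_mul_cancel_right]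
  rfl

open Classical in
theorem columnAntisymmetrizer_eq_sum : columnAntisymmetrizer lam =
    ∑ σ : BoxPerm lam with PreservesCols σ,
      MonoidAlgebra.single σ ((Equiv.Perm.sign σ : ℤ) : ℂ) := by
  unfold columnAntisymmetrizer PreservesCols
  congr!

open Classical in
theorem rowSymmetrizer_eq_sum : rowSymmetrizer lam =
    ∑ σ : BoxPerm lam with PreservesRows σ, MonoidAlgebra.single σ 1 := by
  unfold rowSymmetrizer PreservesRows
  congr!

theorem columnAntisymmetrizer_mul_of {σ : BoxPerm lam} (hσ : PreservesCols σ) :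
    columnAntisymmetrizer lam * MonoidAlgebra.single σ (1 : ℂ) =
      ((Equiv.Perm.sign σ : ℤ) : ℂ) • columnAntisymmetrizer lam := by
  classical
  rw [columnAntisymmetrizer_eq_sum, Finset.sum_mul, Finset.smul_sum]
  refine Finset.sum_bij (fun τ _ => τ * σ) ?_ ?_ ?_ ?_
  · intro τ hτ
    simp only [Finset.mem_filter, Finset.mem_univ, true_and] at hτ ⊢
    exact hτ.mul hσ
  · intro τ _ τ' _ h
    exact mul_right_cancel h
  · intro τ hτ
    simp only [Finset.mem_filter, Finset.mem_univ, true_and] at hτ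
    exact ⟨τ * σ⁻¹, by simpa using hτ.mul hσ.inv, by simp⟩
  · intro τ _
    rw [MonoidAlgebra.single_mul_single, MonoidAlgebra.smul_single, Equiv.Perm.sign_mul]
    rcases Int.units_eq_one_or (Equiv.Perm.sign σ) with h | h <;> simp [h]

theorem of_mul_rowSymmetrizer {σ : BoxPerm lam} (hσ : PreservesRows σ) :
    MonoidAlgebra.single σ (1 : ℂ) * rowSymmetrizer lam = rowSymmetrizer lam := by
  classical
  rw [rowSymmetrizer_eq_sum, Finset.mul_sum]
  refine Finset.sum_bij (fun τ _ => σ * τ) ?_ ?_ ?_ ?_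
  · intro τ hτ
    simp only [Finset.mem_filter, Finset.mem_univ, true_and] at hτ ⊢
    exact hσ.mul hτ
  · intro τ _ τ' _ h
    exact mul_left_cancel h
  · intro τ hτ
    simp only [Finset.mem_filter, Finset.mem_univ, true_and] at hτ
    exact ⟨σ⁻¹ * τ, by simpa using hσ.inv.mul hτ, by simp⟩
  · intro τ _
    rw [MonoidAlgebra.single_mul_single, one_mul]

/-- If `g` separates the boxes of each row into distinct columns, it factors and both factors are
absorbed. Otherwise a transposition inside a row is conjugated by `g` into one inside a column; the
row symmetrizer absorbs the first with sign `1`, the column antisymmetrizer the second with sign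
`-1`, and the product vanishes. -/
theorem columnAntisymmetrizer_mul_of_mul_rowSymmetrizer (g : BoxPerm lam) :
    ∃ s : ℂ, columnAntisymmetrizer lam * MonoidAlgebra.single g (1 : ℂ) * rowSymmetrizer lam =
      s • (columnAntisymmetrizer lam * rowSymmetrizer lam) := by
  classical
  by_cases hg : ∀ x y : lam.cells, x.1.1 = y.1.1 → (g x).1.2 = (g y).1.2 → x = y
  · obtain ⟨σ, τ, hσ, hτ, rfl⟩ := exists_eq_mul_of_separates g hg
    refine ⟨((Equiv.Perm.sign σ : ℤ) : ℂ), ?_⟩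
    rw [← one_mul (1 : ℂ), ← MonoidAlgebra.single_mul_single, ← mul_assoc,
      columnAntisymmetrizer_mul_of hσ, mul_assoc, of_mul_rowSymmetrizer hτ, smul_mul_assoc]
  · push Not at hg
    obtain ⟨x, y, hrow, hcol, hxy⟩ := hg
    refine ⟨0, ?_⟩
    rw [zero_smul]
    have ht : PreservesRows (Equiv.swap x y) := fun z => by
      rw [Equiv.swap_apply_def]
      split_ifs with h1 h2
      · rw [h1, hrow]
      · rw [h2, hrow]
      · rfl
    have ht' : PreservesCols (Equiv.swap (g x) (g y)) := fun z => by
      rw [Equiv.swap_apply_def]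
      split_ifs with h1 h2
      · rw [h1, hcol]
      · rw [h2, hcol]
      · rfl
    have hcomm : g * Equiv.swap x y = Equiv.swap (g x) (g y) * g :=
      Equiv.mul_swap_eq_swap_mul g x y
    have h : columnAntisymmetrizer lam * MonoidAlgebra.single g (1 : ℂ) * rowSymmetrizer lam =
        -(columnAntisymmetrizer lam * MonoidAlgebra.single g (1 : ℂ) * rowSymmetrizer lam) := by
      conv_lhs => rw [← of_mul_rowSymmetrizer ht, ← mul_assoc, mul_assoc (columnAntisymmetrizer lam),
        MonoidAlgebra.single_mul_single, hcomm, ← MonoidAlgebra.single_mul_single, ← mul_assoc,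
        columnAntisymmetrizer_mul_of ht', Equiv.Perm.sign_swap (fun h => hxy (g.injective h))]
      simp
    have h2 := eq_neg_iff_add_eq_zero.1 h
    rw [← two_smul ℂ] at h2
    exact (smul_eq_zero.1 h2).resolve_left two_ne_zero

variable (lam) in
/-- The Young symmetrizer `b_lam * a_lam`. -/
def youngSymmetrizer : BoxAlgebra lam := columnAntisymmetrizer lam * rowSymmetrizer lam

theorem youngSymmetrizer_mul_self :
    ∃ α : ℂ, youngSymmetrizer lam * youngSymmetrizer lam = α • youngSymmetrizer lam := by
  choose s hs using columnAntisymmetrizer_mul_of_mul_rowSymmetrizer (lam := lam)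
  let L : BoxAlgebra lam →ₗ[ℂ] BoxAlgebra lam :=
    (LinearMap.mulRight ℂ (rowSymmetrizer lam)).comp
      (LinearMap.mulLeft ℂ (columnAntisymmetrizer lam))
  have hL : ∀ y, ∃ α : ℂ, L y = α • youngSymmetrizer lam := by
    intro y
    refine ⟨(MonoidAlgebra.basis (BoxPerm lam) ℂ).constr ℂ s y, ?_⟩
    have : L = ((MonoidAlgebra.basis (BoxPerm lam) ℂ).constr ℂ s).smulRight
        (youngSymmetrizer lam) := by
      refine (MonoidAlgebra.basis (BoxPerm lam) ℂ).ext fun g => ?_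
      rw [LinearMap.smulRight_apply, Module.Basis.constr_basis, MonoidAlgebra.basis_apply]
      exact hs g
    rw [this, LinearMap.smulRight_apply]
  obtain ⟨α, hα⟩ := hL (rowSymmetrizer lam * columnAntisymmetrizer lam)
  refine ⟨α, ?_⟩
  rw [← hα]
  simp only [L, youngSymmetrizer, LinearMap.comp_apply, LinearMap.mulLeft_apply,
    LinearMap.mulRight_apply, mul_assoc]

end YoungSymmetrizer

/-! ### Characters through the Young symmetrizer -/

section Character

variable {lam : YoungDiagram}

theorem MonoidAlgebra.trace_mulLeft_mulRight {G : Type*} [Group G] [Fintype G] (g : G)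
    (c : MonoidAlgebra ℂ G) :
    LinearMap.trace ℂ (MonoidAlgebra ℂ G)
        ((LinearMap.mulRight ℂ c).comp (LinearMap.mulLeft ℂ (MonoidAlgebra.single g 1))) =
      ∑ h : G, c.coeff (h⁻¹ * g⁻¹ * h) := by
  classical
  rw [LinearMap.trace_eq_matrix_trace ℂ (MonoidAlgebra.basis G ℂ), Matrix.trace]
  refine Finset.sum_congr rfl fun h _ => ?_
  rw [Matrix.diag_apply, LinearMap.toMatrix_apply, LinearMap.comp_apply, LinearMap.mulLeft_apply,
    LinearMap.mulRight_apply, MonoidAlgebra.basis_apply, MonoidAlgebra.single_mul_single]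
  change (MonoidAlgebra.single (g * h) (1 * 1) * c).coeff h = _
  rw [MonoidAlgebra.coeff_single_mul_apply]
  simp [mul_assoc]

/-- The operator `x ↦ g * x * y` maps the whole algebra into the left ideal of `y`, so its trace can
be taken there, where right multiplication by `y` is the scalar `α`. -/
theorem smul_spechtRep_character {α : ℂ}
    (hα : youngSymmetrizer lam * youngSymmetrizer lam = α • youngSymmetrizer lam)
    (g : BoxPerm lam) :
    α * (spechtRep lam).character g =
      ∑ h : BoxPerm lam, (youngSymmetrizer lam).coeff (h⁻¹ * g⁻¹ * h) := by
  rw [← MonoidAlgebra.trace_mulLeft_mulRight]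
  set T := (LinearMap.mulRight ℂ (youngSymmetrizer lam)).comp
    (LinearMap.mulLeft ℂ (MonoidAlgebra.single g (1 : ℂ)))
  let p : Submodule ℂ (BoxAlgebra lam) := (spechtSpace lam).restrictScalars ℂ
  have hp : ∀ x, T x ∈ p := fun x => Submodule.mem_span_singleton.2 ⟨_, rfl⟩
  rw [← LinearMap.trace_restrict_eq_of_forall_mem p T hp, Representation.character,
    ← smul_eq_mul, ← map_smul]
  change LinearMap.trace ℂ p _ = LinearMap.trace ℂ p _
  congr 1
  refine LinearMap.ext fun x => Subtype.ext ?_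
  obtain ⟨x, hx⟩ := x
  obtain ⟨y, rfl⟩ := Submodule.mem_span_singleton.1 hx
  change α • (MonoidAlgebra.single g (1 : ℂ) * (y * youngSymmetrizer lam)) =
    MonoidAlgebra.single g (1 : ℂ) * (y * youngSymmetrizer lam) * youngSymmetrizer lam
  rw [mul_assoc, mul_assoc y, hα, mul_smul_comm, mul_smul_comm]

open Classical in
theorem coeff_youngSymmetrizer (g : BoxPerm lam) :
    (youngSymmetrizer lam).coeff g =
      ∑ σ : BoxPerm lam, if PreservesCols σ ∧ PreservesRows (σ⁻¹ * g) then
        ((Equiv.Perm.sign σ : ℤ) : ℂ) else 0 := by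
  rw [youngSymmetrizer, columnAntisymmetrizer_eq_sum, rowSymmetrizer_eq_sum, Finset.sum_mul,
    Finset.sum_filter, MonoidAlgebra.coeff_sum, Finset.sum_apply']
  refine Finset.sum_congr rfl fun σ _ => ?_
  by_cases hσ : PreservesCols σ
  · simp only [hσ, if_true, true_and]
    rw [MonoidAlgebra.coeff_single_mul_apply, MonoidAlgebra.coeff_sum, Finset.sum_apply']
    simp [MonoidAlgebra.coeff_single, Finsupp.single_apply, Finset.sum_ite_eq']
  · simp [hσ]

theorem PreservesCols.eq_one {σ : BoxPerm lam} (h : PreservesCols σ) (h' : PreservesRows σ) :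
    σ = 1 := Equiv.ext fun x => YoungDiagram.cells_ext (h' x) (h x)

theorem coeff_youngSymmetrizer_one : (youngSymmetrizer lam).coeff 1 = 1 := by
  classical
  rw [coeff_youngSymmetrizer, Finset.sum_eq_single 1]
  · rw [if_pos ⟨fun _ => rfl, fun _ => rfl⟩]
    simp
  · intro σ _ hσ
    rw [if_neg]
    rintro ⟨h1, h2⟩
    rw [mul_one] at h2
    exact hσ (h1.eq_one (by simpa using h2.inv))
  · simp

/-- At the identity the trace formula reads `α * dim = n!`, because `y` has coefficient `1` there.
So `α ≠ 0`, and it cancels without being computed. -/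
theorem spechtRep_character_div (g : BoxPerm lam) :
    (spechtRep lam).character g / (spechtRep lam).character 1 =
      (∑ h : BoxPerm lam, (youngSymmetrizer lam).coeff (h⁻¹ * g⁻¹ * h)) / lam.card.factorial := by
  obtain ⟨α, hα⟩ := youngSymmetrizer_mul_self (lam := lam)
  have h1 := smul_spechtRep_character hα 1
  simp only [inv_one, mul_one, inv_mul_cancel, coeff_youngSymmetrizer_one, Finset.sum_const,
    Finset.card_univ, Fintype.card_perm, Fintype.card_coe, nsmul_eq_mul] at h1
  change _ = ((lam.card.factorial : ℕ) : ℂ) at h1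
  have hne : α * (spechtRep lam).character 1 ≠ 0 := by
    rw [h1]
    exact_mod_cast lam.card.factorial_ne_zero
  rw [← h1, ← smul_spechtRep_character hα, mul_div_mul_left _ _ (left_ne_zero_of_mul hne)]

end Character

/-! ### Sums over embeddings -/

/-- Double counting of the sum of `F (g • x)` over all pairs: by transitivity the inner sum over `g`
does not depend on `x`. -/
theorem MulAction.card_mul_sum_smul {G X : Type*} [Group G] [Fintype G] [Fintype X] [MulAction G X]
    [MulAction.IsPretransitive G X] (F : X → ℂ) (x₀ : X) :
    (Fintype.card X : ℂ) * ∑ g : G, F (g • x₀) = Fintype.card G * ∑ x, F x := by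
  have h1 : ∀ x, ∑ g : G, F (g • x) = ∑ g : G, F (g • x₀) := by
    intro x
    obtain ⟨h, rfl⟩ := MulAction.exists_smul_eq G x₀ x
    exact Fintype.sum_equiv (Equiv.mulRight h) _ _ fun g => by simp [mul_smul]
  have h2 : ∀ g : G, ∑ x, F (g • x) = ∑ x, F x := fun g =>
    Fintype.sum_equiv (MulAction.toPerm g) _ _ fun x => rfl
  calc (Fintype.card X : ℂ) * ∑ g : G, F (g • x₀) = ∑ x, ∑ g : G, F (g • x) := by
        simp [h1]
    _ = ∑ g : G, ∑ x, F (g • x) := Finset.sum_comm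
    _ = _ := by simp [h2]

namespace Equiv.Perm

variable {α β : Type*}

theorem eq_viaEmbedding {σ : Perm α} {f : α ↪ β} {ρ : Perm β} (h1 : ∀ a, ρ (f a) = f (σ a))
    (h2 : ∀ b ∉ Set.range f, ρ b = b) : ρ = σ.viaEmbedding f := by
  ext b
  by_cases hb : b ∈ Set.range f
  · obtain ⟨a, rfl⟩ := hb
    rw [h1, viaEmbedding_apply]
  · rw [h2 b hb, viaEmbedding_apply_of_notMem _ _ _ hb]

theorem permCongr_viaEmbedding {γ : Type*} (σ : Perm α) (f : α ↪ β) (e : β ≃ γ) :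
    e.permCongr (σ.viaEmbedding f) = σ.viaEmbedding (f.trans e.toEmbedding) := by
  refine eq_viaEmbedding (fun a => ?_) fun b hb => ?_
  · simp [viaEmbedding_apply]
  · rw [Equiv.permCongr_apply, viaEmbedding_apply_of_notMem, Equiv.apply_symm_apply]
    rintro ⟨a, ha⟩
    exact hb ⟨a, by simp [ha]⟩

theorem conj_viaEmbedding (σ : Perm α) (f : α ↪ β) (h : Perm β) :
    h * σ.viaEmbedding f * h⁻¹ = σ.viaEmbedding (h • f) := by
  have := permCongr_viaEmbedding σ f h
  rw [Equiv.permCongr_eq_mul] at this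
  exact this

theorem viaEmbedding_inv (σ : Perm α) (f : α ↪ β) :
    (σ.viaEmbedding f)⁻¹ = σ⁻¹.viaEmbedding f :=
  (map_inv (viaEmbeddingHom f) σ).symm

theorem viaEmbedding_mul (σ τ : Perm α) (f : α ↪ β) :
    (σ * τ).viaEmbedding f = σ.viaEmbedding f * τ.viaEmbedding f :=
  map_mul (viaEmbeddingHom f) σ τ

theorem sign_viaEmbedding [Fintype α] [DecidableEq α] [Fintype β] [DecidableEq β] (σ : Perm α)
    (f : α ↪ β) : sign (σ.viaEmbedding f) = sign σ := by
  classical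
  rw [viaEmbedding]
  convert! sign_extendDomain σ (Equiv.ofInjective f.1 f.2)

end Equiv.Perm

/-- Conjugating `π` moves the embedding along which it acts, so the sum over conjugates becomes an
average over embeddings. The falling factorial is their number, also when `l > n` and there are
none. -/
theorem normalizedCharacter_eq_sum_embedding (lam : YoungDiagram) {l : ℕ}
    (π : Equiv.Perm (Fin l)) :
    normalizedCharacter lam π =
      ∑ f : Fin l ↪ lam.cells, (youngSymmetrizer lam).coeff (π⁻¹.viaEmbedding f) := by
  rw [normalizedCharacter]
  have hcard : Fintype.card (Fin l ↪ lam.cells) = lam.card.descFactorial l := by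
    rw [Fintype.card_embedding_eq, Fintype.card_fin, Fintype.card_coe]
  split_ifs with h
  · set ι : Fin l ↪ lam.cells := (Fin.castLEEmb h).trans lam.cells.equivFin.symm.toEmbedding
    have hι : toBoxPerm lam h π = π.viaEmbedding ι := Equiv.Perm.permCongr_viaEmbedding _ _ _
    have : MulAction.IsPretransitive (BoxPerm lam) (Fin l ↪ lam.cells) :=
      ⟨Equiv.Perm.exists_smul_eq_embedding⟩
    have key := MulAction.card_mul_sum_smul (G := BoxPerm lam)
      (fun f : Fin l ↪ lam.cells => (youngSymmetrizer lam).coeff (π⁻¹.viaEmbedding f)) ι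
    rw [hcard, Fintype.card_perm, Fintype.card_coe] at key
    rw [spechtRep_character_div, hι, ← mul_div_assoc, div_eq_iff
      (by exact_mod_cast lam.card.factorial_ne_zero), mul_comm (∑ f, _)]
    refine Eq.trans ?_ key
    congr 1
    refine Fintype.sum_equiv (Equiv.inv _) _ _ fun h => ?_
    rw [Equiv.Perm.viaEmbedding_inv, Equiv.inv_apply, ← Equiv.Perm.conj_viaEmbedding, inv_inv]
  · have : IsEmpty (Fin l ↪ lam.cells) := by
      rw [← Fintype.card_eq_zero_iff, hcard, Nat.descFactorial_eq_zero_iff_lt]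
      exact not_le.1 h
    simp

/-! ### Fillings compatible with two permutations -/

/-- The columns of the boxes `f i` are constant along the cycles of `σ`, and their rows are constant
along the cycles of `τ`. -/
def IsCompatible {lam : YoungDiagram} {α : Type*} (σ τ : Equiv.Perm α) (f : α → lam.cells) :
    Prop :=
  (∀ i, (f (σ i)).1.2 = (f i).1.2) ∧ ∀ i, (f (τ i)).1.1 = (f i).1.1

open Classical in
-- Outside the range of `f` the permutation is trivial, so there its column factor preserves rows as
-- well as columns and is trivial too. The factorizations therefore all come from permutations of
-- `α`, with the same sign.
theorem coeff_youngSymmetrizer_viaEmbedding (lam : YoungDiagram) {α : Type*} [Fintype α]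
    [DecidableEq α] (ρ : Equiv.Perm α) (f : α ↪ lam.cells) :
    (youngSymmetrizer lam).coeff (ρ.viaEmbedding f) =
      ∑ σ : Equiv.Perm α,
        if IsCompatible σ (σ⁻¹ * ρ) f then ((Equiv.Perm.sign σ : ℤ) : ℂ) else 0 := by
  have hcol : ∀ σ : Equiv.Perm α, PreservesCols (σ.viaEmbedding f) ↔
      ∀ i, (f (σ i)).1.2 = (f i).1.2 := by
    intro σ
    refine ⟨fun h i => by rw [← Equiv.Perm.viaEmbedding_apply σ f, h], fun h x => ?_⟩
    by_cases hx : x ∈ Set.range f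
    · obtain ⟨i, rfl⟩ := hx
      rw [Equiv.Perm.viaEmbedding_apply, h]
    · rw [Equiv.Perm.viaEmbedding_apply_of_notMem _ _ _ hx]
  have hrow : ∀ σ : Equiv.Perm α, PreservesRows (σ.viaEmbedding f) ↔
      ∀ i, (f (σ i)).1.1 = (f i).1.1 := by
    intro σ
    refine ⟨fun h i => by rw [← Equiv.Perm.viaEmbedding_apply σ f, h], fun h x => ?_⟩
    by_cases hx : x ∈ Set.range f
    · obtain ⟨i, rfl⟩ := hx
      rw [Equiv.Perm.viaEmbedding_apply, h]
    · rw [Equiv.Perm.viaEmbedding_apply_of_notMem _ _ _ hx]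
  rw [coeff_youngSymmetrizer, ← Finset.sum_filter, ← Finset.sum_filter]
  symm
  refine Finset.sum_bij (fun σ _ => σ.viaEmbedding f) ?_ ?_ ?_ ?_
  · intro σ hσ
    simp only [Finset.mem_filter, Finset.mem_univ, true_and] at hσ ⊢
    rw [Equiv.Perm.viaEmbedding_inv, ← Equiv.Perm.viaEmbedding_mul]
    exact ⟨(hcol σ).2 hσ.1, (hrow _).2 hσ.2⟩
  · intro σ _ σ' _ h
    exact Equiv.Perm.viaEmbeddingHom_injective f h
  · intro σ hσ
    simp only [Finset.mem_filter, Finset.mem_univ, true_and] at hσ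
    have hfix : ∀ x ∉ Set.range f, σ x = x := by
      intro x hx
      have h1 := hσ.2 x
      rw [Equiv.Perm.mul_apply, Equiv.Perm.viaEmbedding_apply_of_notMem _ _ _ hx] at h1
      have h2 : σ⁻¹ x = x := YoungDiagram.cells_ext h1 (hσ.1.inv x)
      rw [← h2, ← Equiv.Perm.mul_apply, mul_inv_cancel, h2, Equiv.Perm.one_apply]
    have hmem : ∀ i, ∃ j, f j = σ (f i) := by
      intro i
      by_contra hc
      have := hfix (σ (f i)) hc
      exact hc ⟨i, (σ.injective this).symm⟩
    choose g hg using hmem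
    have hginj : Function.Injective g := fun i j h => by
      have := congrArg f h
      rw [hg, hg] at this
      exact f.injective (σ.injective this)
    let σ₁ : Equiv.Perm α := Equiv.ofBijective g (Finite.injective_iff_bijective.1 hginj)
    have hσ₁ : σ = σ₁.viaEmbedding f :=
      Equiv.Perm.eq_viaEmbedding (fun i => (hg i).symm) hfix
    refine ⟨σ₁, ?_, hσ₁.symm⟩
    rw [hσ₁, Equiv.Perm.viaEmbedding_inv, ← Equiv.Perm.viaEmbedding_mul, hcol, hrow] at hσ
    simp only [Finset.mem_filter, Finset.mem_univ, true_and]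
    exact hσ
  · intro σ _
    rw [Equiv.Perm.sign_viaEmbedding]

open Classical in
-- If `f i = f j`, then `σ ↦ σ * swap i j` preserves compatibility and reverses the sign. This
-- extends the character sum from embeddings to all maps.
theorem sum_sign_isCompatible_eq_zero {lam : YoungDiagram} {α : Type*} [Fintype α]
    [DecidableEq α] (ρ : Equiv.Perm α) {f : α → lam.cells} (hf : ¬ Function.Injective f) :
    ∑ σ : Equiv.Perm α, (if IsCompatible σ (σ⁻¹ * ρ) f then
      ((Equiv.Perm.sign σ : ℤ) : ℂ) else 0) = 0 := by
  rw [Function.not_injective_iff] at hf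
  obtain ⟨i, j, hij, hne⟩ := hf
  have hswap : ∀ k, f (Equiv.swap i j k) = f k := by
    intro k
    rw [Equiv.swap_apply_def]
    split_ifs with h1 h2
    · rw [h1, hij]
    · rw [h2, hij]
    · rfl
  set S := ∑ σ : Equiv.Perm α, (if IsCompatible σ (σ⁻¹ * ρ) f then
      ((Equiv.Perm.sign σ : ℤ) : ℂ) else 0) with hS
  have h : S = -S := by
    conv_lhs => rw [hS]
    rw [← Equiv.sum_comp (Equiv.mulRight (Equiv.swap i j)), hS, ← Finset.sum_neg_distrib]
    refine Finset.sum_congr rfl fun σ _ => ?_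
    have hiff : IsCompatible (σ * Equiv.swap i j) ((σ * Equiv.swap i j)⁻¹ * ρ) f ↔
        IsCompatible σ (σ⁻¹ * ρ) f := by
      rw [_root_.mul_inv_rev, Equiv.swap_inv, mul_assoc]
      simp only [IsCompatible, Equiv.Perm.mul_apply, hswap]
      refine and_congr_left fun _ => ?_
      rw [← (Equiv.swap i j).forall_congr_right
        (q := fun k => (f (σ k)).1.2 = (f k).1.2)]
      simp only [hswap]
    simp only [Equiv.coe_mulRight, hiff, Equiv.Perm.sign_mul, Equiv.Perm.sign_swap hne]
    split_ifs <;> simp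
  have h2 := eq_neg_iff_add_eq_zero.1 h
  rw [← two_mul] at h2
  exact (mul_eq_zero.1 h2).resolve_left two_ne_zero

open Classical in
/-- The character formula of Stanley and Féray. -/
theorem normalizedCharacter_eq_sum (lam : YoungDiagram) {l : ℕ} (π : Equiv.Perm (Fin l)) :
    normalizedCharacter lam π = ∑ σ : Equiv.Perm (Fin l), ((Equiv.Perm.sign σ : ℤ) : ℂ) *
      Fintype.card {f : Fin l → lam.cells // IsCompatible σ (σ⁻¹ * π⁻¹) f} := by
  rw [normalizedCharacter_eq_sum_embedding]
  simp_rw [coeff_youngSymmetrizer_viaEmbedding]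
  have h1 : ∑ f : Fin l ↪ lam.cells, ∑ σ : Equiv.Perm (Fin l),
        (if IsCompatible σ (σ⁻¹ * π⁻¹) f then ((Equiv.Perm.sign σ : ℤ) : ℂ) else 0) =
      ∑ f : Fin l → lam.cells, ∑ σ : Equiv.Perm (Fin l),
        (if IsCompatible σ (σ⁻¹ * π⁻¹) f then ((Equiv.Perm.sign σ : ℤ) : ℂ) else 0) := by
    refine Finset.sum_of_injOn (fun f : Fin l ↪ lam.cells => (f : Fin l → lam.cells))
      (DFunLike.coe_injective.injOn) (fun _ _ => Finset.mem_coe.2 (Finset.mem_univ _)) ?_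
      fun _ _ => rfl
    intro f _ hf
    refine sum_sign_isCompatible_eq_zero _ fun hinj => hf ?_
    exact ⟨⟨f, hinj⟩, Finset.mem_coe.2 (Finset.mem_univ _), rfl⟩
  rw [h1, Finset.sum_comm]
  refine Finset.sum_congr rfl fun σ _ => ?_
  rw [Fintype.card_subtype, ← Finset.sum_filter, Finset.sum_const, nsmul_eq_mul, mul_comm]

/-! ### Moments of complex Gaussian variables -/

section Gaussian

open Real in
theorem stdComplexGaussian_eq_withDensity : stdComplexGaussian =
    (volume : Measure ℂ).withDensity fun z => ENNReal.ofReal (π⁻¹ * rexp (-‖z‖ ^ 2)) := by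
  have hv : (1 / 2 : NNReal) ≠ 0 := by norm_num
  have hmp := Complex.volume_preserving_equiv_real_prod.symm
  have hfun : (fun z : ℝ × ℝ => (⟨z.1, z.2⟩ : ℂ)) = Complex.measurableEquivRealProd.symm := rfl
  have hdens : (fun z : ℝ × ℝ => gaussianPDF 0 (1 / 2) z.1 * gaussianPDF 0 (1 / 2) z.2) =
      fun z => ENNReal.ofReal
        (π⁻¹ * rexp (-‖Complex.measurableEquivRealProd.symm z‖ ^ 2)) := by
    funext z
    rw [gaussianPDF, gaussianPDF, ← ENNReal.ofReal_mul (gaussianPDFReal_nonneg _ _ _)]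
    congr 1
    have hn : ‖Complex.measurableEquivRealProd.symm z‖ ^ 2 = z.1 ^ 2 + z.2 ^ 2 := by
      rw [← Complex.normSq_eq_norm_sq, Complex.normSq_apply]
      change z.1 * z.1 + z.2 * z.2 = _
      ring
    have h2 : 2 * π * ((1 / 2 : NNReal) : ℝ) = π := by
      push_cast
      ring
    rw [hn, gaussianPDFReal, gaussianPDFReal, h2, mul_mul_mul_comm, ← mul_inv,
      mul_self_sqrt pi_pos.le, ← exp_add]
    congr 2
    push_cast
    ring
  rw [stdComplexGaussian, gaussianReal_of_var_ne_zero _ hv,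
    prod_withDensity (measurable_gaussianPDF _ _) (measurable_gaussianPDF _ _), hdens, hfun]
  ext s hs
  rw [MeasurableEquiv.map_apply, withDensity_apply _ (MeasurableEquiv.measurable _ hs),
    withDensity_apply _ hs]
  exact hmp.setLIntegral_comp_preimage_emb (MeasurableEquiv.measurableEmbedding _)
    (fun z => ENNReal.ofReal (π⁻¹ * rexp (-‖z‖ ^ 2))) s

instance : IsProbabilityMeasure stdComplexGaussian :=
  Measure.isProbabilityMeasure_map
    (Complex.measurableEquivRealProd.symm.measurable.aemeasurable)

open Real in
theorem integral_stdComplexGaussian (f : ℂ → ℂ) :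
    ∫ z, f z ∂stdComplexGaussian = ∫ z, (π⁻¹ * rexp (-‖z‖ ^ 2)) • f z := by
  rw [stdComplexGaussian_eq_withDensity, integral_withDensity_eq_integral_toReal_smul]
  · refine integral_congr_ae (Filter.Eventually.of_forall fun z => ?_)
    dsimp only
    rw [ENNReal.toReal_ofReal (by positivity)]
  · fun_prop
  · exact Filter.Eventually.of_forall fun z => ENNReal.ofReal_lt_top

open Real in
theorem integrable_stdComplexGaussian_iff (f : ℂ → ℂ) :
    Integrable f stdComplexGaussian ↔ Integrable fun z => (π⁻¹ * rexp (-‖z‖ ^ 2)) • f z := by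
  rw [stdComplexGaussian_eq_withDensity, integrable_withDensity_iff_integrable_smul']
  · refine integrable_congr (Filter.Eventually.of_forall fun z => ?_)
    dsimp only
    rw [ENNReal.toReal_ofReal (by positivity)]
  · fun_prop
  · exact Filter.Eventually.of_forall fun z => ENNReal.ofReal_lt_top

open Real in
theorem integral_norm_pow_mul_exp_neg_norm_sq (n : ℕ) :
    ∫ z : ℂ, ‖z‖ ^ n * rexp (-‖z‖ ^ 2) = π * Real.Gamma ((n + 2) / 2) := by
  have h := Complex.integral_rpow_mul_exp_neg_rpow (p := 2) (q := n) one_le_two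
    (lt_of_lt_of_le (by norm_num) n.cast_nonneg)
  rw [mul_div_cancel_left₀ _ two_ne_zero] at h
  rw [← h]
  refine integral_congr_ae (Filter.Eventually.of_forall fun z => ?_)
  simp

open Real in
theorem integrable_pow_mul_conj_pow (a b : ℕ) :
    Integrable (fun z : ℂ => z ^ a * (starRingEnd ℂ z) ^ b) stdComplexGaussian := by
  rw [integrable_stdComplexGaussian_iff]
  have h1 : Integrable fun z : ℂ => ‖z‖ ^ (a + b) * rexp (-‖z‖ ^ 2) := by
    -- A function that is not integrable has integral `0` by convention, so a positive value of the
    -- integral already proves integrability.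
    refine Integrable.of_integral_ne_zero ?_
    rw [integral_norm_pow_mul_exp_neg_norm_sq]
    exact (mul_pos pi_pos (Real.Gamma_pos_of_pos (by positivity))).ne'
  refine (h1.const_mul π⁻¹).mono' (by fun_prop) (Filter.Eventually.of_forall fun z => le_of_eq ?_)
  rw [norm_smul, Real.norm_of_nonneg (by positivity), norm_mul, norm_pow, norm_pow,
    RCLike.norm_conj]
  ring

theorem integral_pow_mul_conj_pow_rotate (a b : ℕ) (u : Circle) :
    (u : ℂ) ^ a * (starRingEnd ℂ (u : ℂ)) ^ b *
        ∫ z, z ^ a * (starRingEnd ℂ z) ^ b ∂stdComplexGaussian =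
      ∫ z, z ^ a * (starRingEnd ℂ z) ^ b ∂stdComplexGaussian := by
  rw [integral_stdComplexGaussian, ← integral_const_mul]
  conv_rhs => rw [← (LinearIsometryEquiv.measurePreserving (rotation u)).integral_comp
    (rotation u).toHomeomorph.measurableEmbedding]
  refine integral_congr_ae (Filter.Eventually.of_forall fun z => ?_)
  simp only [rotation_apply, norm_mul, Circle.norm_coe, one_mul, map_mul, mul_pow,
    Complex.real_smul]
  ring

open Real in
theorem integral_pow_mul_conj_pow (a b : ℕ) :
    ∫ z, z ^ a * (starRingEnd ℂ z) ^ b ∂stdComplexGaussian =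
      if a = b then (a.factorial : ℂ) else 0 := by
  split_ifs with hab
  · subst hab
    rw [integral_stdComplexGaussian]
    have h : ∀ z : ℂ, (π⁻¹ * rexp (-‖z‖ ^ 2)) • (z ^ a * (starRingEnd ℂ z) ^ a) =
        ((π⁻¹ * (‖z‖ ^ (2 * a) * rexp (-‖z‖ ^ 2)) : ℝ) : ℂ) := by
      intro z
      rw [← mul_pow, Complex.mul_conj, Complex.normSq_eq_norm_sq, Complex.real_smul]
      push_cast
      ring
    simp_rw [h]
    rw [integral_complex_ofReal, integral_const_mul, integral_norm_pow_mul_exp_neg_norm_sq,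
      inv_mul_cancel_left₀ pi_pos.ne']
    have : ((2 * a : ℕ) + 2 : ℝ) / 2 = a + 1 := by
      push_cast
      ring
    rw [this, Real.Gamma_nat_eq_factorial]
    simp
  · set I := ∫ z, z ^ a * (starRingEnd ℂ z) ^ b ∂stdComplexGaussian with hI
    have hd : ((a : ℝ) - b) ≠ 0 := sub_ne_zero.2 (by exact_mod_cast hab)
    -- For this angle the rotation factor `u ^ a * conj u ^ b` is `exp (π * I) = -1`, so the
    -- integral equals its own negative.
    have h := integral_pow_mul_conj_pow_rotate a b (Circle.exp (π / (a - b)))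
    rw [← hI, Circle.coe_exp, ← Complex.exp_conj, ← Complex.exp_nat_mul, ← Complex.exp_nat_mul,
      ← Complex.exp_add] at h
    have he : (a : ℂ) * (((π / (a - b) : ℝ) : ℂ) * Complex.I) +
        b * (starRingEnd ℂ) (((π / (a - b) : ℝ) : ℂ) * Complex.I) = π * Complex.I := by
      rw [map_mul, Complex.conj_ofReal, Complex.conj_I]
      have : ((a : ℂ) - b) ≠ 0 := by exact_mod_cast hd
      push_cast
      field_simp
      ring
    rw [he, Complex.exp_pi_mul_I, neg_one_mul, neg_eq_iff_add_eq_zero, ← two_mul] at h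
    exact (mul_eq_zero.1 h).resolve_left two_ne_zero

end Gaussian

/-! ### Wick's formula -/

section Wick

variable {α ι : Type*} [Fintype α] [Fintype ι] [DecidableEq ι]

/-- The number of permutations which carry one colouring into another. -/
theorem card_perm_comp_eq [DecidableEq α] (x y : α → ι) :
    Fintype.card {σ : Equiv.Perm α // x ∘ σ = y} =
      ∏ k, if Fintype.card {a // x a = k} = Fintype.card {a // y a = k} then
        (Fintype.card {a // x a = k}).factorial else 0 := by
  by_cases h : ∀ k, Fintype.card {a // x a = k} = Fintype.card {a // y a = k}
  · have e : ∀ k, {a // y a = k} ≃ {a // x a = k} := fun k => Fintype.equivOfCardEq (h k).symm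
    -- One solution, glued from bijections of the fibres; all solutions then form a coset of the
    -- stabilizer of `x`, of order the product of the factorials.
    let σ₀ : Equiv.Perm α := (Equiv.sigmaFiberEquiv y).symm.trans
      ((Equiv.sigmaCongrRight e).trans (Equiv.sigmaFiberEquiv x))
    have hσ₀ : x ∘ σ₀ = y := funext fun a => (e (y a) ⟨a, rfl⟩).2
    have hσ₀' : y ∘ ⇑σ₀⁻¹ = x := by
      rw [← hσ₀]
      funext a
      simp
    simp only [h, if_true]
    simp only [← h]
    rw [← DomMulAct.stabilizer_card]
    refine Fintype.card_congr ((Equiv.mulRight σ₀⁻¹).subtypeEquiv fun σ => ?_)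
    rw [Equiv.coe_mulRight, Equiv.Perm.coe_mul, ← Function.comp_assoc]
    refine ⟨fun hσ => by rw [hσ, hσ₀'], fun hσ => ?_⟩
    rw [← hσ₀]
    conv_rhs => rw [← hσ]
    funext a
    simp
  · push Not at h
    obtain ⟨k, hk⟩ := h
    rw [Finset.prod_eq_zero (Finset.mem_univ k) (if_neg hk), Fintype.card_eq_zero_iff]
    refine ⟨fun σ => hk ?_⟩
    obtain ⟨σ, rfl⟩ := σ
    exact (Fintype.card_congr (σ.subtypeEquiv fun a => Iff.rfl)).symm

theorem prod_mul_conj_eq (x y : α → ι) (t : ι → ℂ) :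
    ∏ a, t (x a) * (starRingEnd ℂ) (t (y a)) =
      ∏ k, t k ^ Fintype.card {a // x a = k} *
        (starRingEnd ℂ) (t k) ^ Fintype.card {a // y a = k} := by
  rw [Finset.prod_mul_distrib, Finset.prod_mul_distrib]
  have key : ∀ (x : α → ι) (t : ι → ℂ), ∏ a, t (x a) = ∏ k, t k ^ Fintype.card {a // x a = k} := by
    intro x t
    rw [← Finset.prod_fiberwise Finset.univ x]
    refine Finset.prod_congr rfl fun k _ => ?_
    rw [Fintype.card_subtype]
    exact Finset.prod_eq_pow_card fun a ha => by rw [(Finset.mem_filter.1 ha).2]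
  rw [key x, key y fun k => (starRingEnd ℂ) (t k)]

theorem integrable_prod_mul_conj (x y : α → ι) :
    Integrable (fun t : ι → ℂ => ∏ a, t (x a) * (starRingEnd ℂ) (t (y a)))
      (Measure.pi fun _ => stdComplexGaussian) := by
  simp_rw [prod_mul_conj_eq]
  exact Integrable.fintype_prod (f := fun k z => z ^ Fintype.card {a // x a = k} *
        (starRingEnd ℂ) z ^ Fintype.card {a // y a = k}) fun k => integrable_pow_mul_conj_pow _ _

/-- By independence the integral factors over `ι`, and each factor is a factorial or `0`: exactly
the factors in the count of the permutations matching `x` with `y`. -/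
theorem integral_prod_mul_conj [DecidableEq α] (x y : α → ι) :
    ∫ t : ι → ℂ, ∏ a, t (x a) * (starRingEnd ℂ) (t (y a))
        ∂(Measure.pi fun _ => stdComplexGaussian) =
      Fintype.card {σ : Equiv.Perm α // x ∘ σ = y} := by
  simp_rw [prod_mul_conj_eq]
  rw [integral_fintype_prod_eq_prod (f := fun k z => z ^ Fintype.card {a // x a = k} *
        (starRingEnd ℂ) z ^ Fintype.card {a // y a = k}), card_perm_comp_eq]
  simp only [integral_pow_mul_conj_pow]
  push_cast
  rfl

end Wick

/-! ### Products of traces as sums over closed paths -/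

section TraceSum

/-- Here `a` lists the interior points of a walk from `x` to `y`; `cons` lists the starting points
of its steps and `snoc` their end points. -/
theorem sum_prod_cons_snoc {ι : Type*} [Fintype ι] [DecidableEq ι] (A : Matrix ι ι ℂ) (n : ℕ)
    (x y : ι) :
    ∑ a : Fin n → ι, ∏ i : Fin (n + 1),
      A (Fin.cons (α := fun _ => ι) x a i) (Fin.snoc (α := fun _ => ι) a y i) =
      (A ^ (n + 1)) x y := by
  induction n generalizing x with
  | zero => simp [Fin.snoc]
  | succ n ih =>
    rw [← (Fin.consEquiv fun _ => ι).sum_comp, Fintype.sum_prod_type, pow_succ', Matrix.mul_apply]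
    refine Finset.sum_congr rfl fun z _ => ?_
    rw [← ih z, Finset.mul_sum]
    refine Finset.sum_congr rfl fun b _ => ?_
    change ∏ i : Fin (n + 2), A (Fin.cons (α := fun _ => ι) x (Fin.cons z b) i)
      (Fin.snoc (α := fun _ => ι) (Fin.cons z b) y i) = _
    rw [Fin.prod_univ_succ, ← Fin.cons_snoc_eq_snoc_cons]
    simp

theorem sum_prod_finRotate {ι : Type*} [Fintype ι] [DecidableEq ι] (A : Matrix ι ι ℂ) (n : ℕ) :
    ∑ a : Fin (n + 1) → ι, ∏ i, A (a i) (a (finRotate (n + 1) i)) = (A ^ (n + 1)).trace := by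
  rw [← (Fin.consEquiv fun _ => ι).sum_comp, Fintype.sum_prod_type, Matrix.trace]
  refine Finset.sum_congr rfl fun x _ => ?_
  rw [Matrix.diag_apply, ← sum_prod_cons_snoc]
  refine Finset.sum_congr rfl fun b _ => ?_
  rw [Fin.snoc_eq_cons_rotate]
  simp

variable {ι : Type*} [Fintype ι] (A : Matrix ι ι ℂ) {α β : Type*}
  [Fintype α] [DecidableEq α] [Fintype β] [DecidableEq β]

theorem sum_prod_permCongr (e : α ≃ β) (π : Equiv.Perm α) :
    ∑ a : β → ι, ∏ i, A (a i) (a (e.permCongr π i)) = ∑ a : α → ι, ∏ i, A (a i) (a (π i)) := by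
  rw [← (e.arrowCongr (Equiv.refl ι)).sum_comp]
  refine Finset.sum_congr rfl fun a _ => ?_
  rw [← e.prod_comp]
  simp

theorem sum_prod_subtypePerm (π : Equiv.Perm α) (p : α → Prop) [DecidablePred p]
    (hp : ∀ x, p (π x) ↔ p x) :
    ∑ a : α → ι, ∏ i, A (a i) (a (π i)) =
      (∑ a : {x // p x} → ι, ∏ i, A (a i) (a (π.subtypePerm hp i))) *
      ∑ a : {x // ¬ p x} → ι, ∏ i, A (a i)
        (a (π.subtypePerm (p := fun x => ¬ p x) (fun x => not_congr (hp x)) i)) := by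
  rw [Fintype.sum_mul_sum, ← Fintype.sum_prod_type',
    ← (Equiv.piEquivPiSubtypeProd p fun _ => ι).sum_comp]
  refine Finset.sum_congr rfl fun a _ => ?_
  rw [← Fintype.prod_subtype_mul_prod_subtype p]
  rfl

theorem Equiv.Perm.parts_partition_subtypePerm (π : Equiv.Perm α) (p : α → Prop) [DecidablePred p]
    (hp : ∀ x, p (π x) ↔ p x) :
    π.partition.parts = (π.subtypePerm hp).partition.parts +
      (π.subtypePerm (p := fun x => ¬ p x) (fun x => not_congr (hp x))).partition.parts := by
  set σ := π.subtypePerm hp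
  set τ := π.subtypePerm (p := fun x => ¬ p x) (fun x => not_congr (hp x))
  have hmul : π = Equiv.Perm.ofSubtype σ * Equiv.Perm.ofSubtype τ := by
    ext x
    rw [Equiv.Perm.mul_apply]
    by_cases hx : p x
    · rw [Equiv.Perm.ofSubtype_apply_of_not_mem τ (not_not.2 hx),
        Equiv.Perm.ofSubtype_apply_of_mem σ hx]
      rfl
    · rw [Equiv.Perm.ofSubtype_apply_of_mem τ hx, Equiv.Perm.ofSubtype_apply_of_not_mem]
      · rfl
      · exact (τ ⟨x, hx⟩).2
  have hdisj : Equiv.Perm.Disjoint (Equiv.Perm.ofSubtype σ) (Equiv.Perm.ofSubtype τ) := by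
    intro x
    by_cases hx : p x
    · exact Or.inr (Equiv.Perm.ofSubtype_apply_of_not_mem τ (not_not.2 hx))
    · exact Or.inl (Equiv.Perm.ofSubtype_apply_of_not_mem σ hx)
  have hct : π.cycleType = σ.cycleType + τ.cycleType := by
    conv_lhs => rw [hmul, hdisj.cycleType_mul, Equiv.Perm.cycleType_ofSubtype,
      Equiv.Perm.cycleType_ofSubtype]
  have hcard := Fintype.card_subtype_compl p
  have hle := Fintype.card_subtype_le p
  have h1 := σ.sum_cycleType_le
  have h2 := τ.sum_cycleType_le
  have : Fintype.card α - π.cycleType.sum =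
      (Fintype.card {x // p x} - σ.cycleType.sum) +
        (Fintype.card {x // ¬ p x} - τ.cycleType.sum) := by
    rw [hct, Multiset.sum_add]
    omega
  simp only [Equiv.Perm.parts_partition, ← Equiv.Perm.sum_cycleType]
  rw [this, hct, Multiset.replicate_add]
  abel

theorem Equiv.Perm.parts_partition_of_sameCycle [Nonempty α] {π : Equiv.Perm α}
    (h : ∀ x y, π.SameCycle x y) : π.partition.parts = {Fintype.card α} := by
  rw [Equiv.Perm.parts_partition]
  rcases subsingleton_or_nontrivial α with hα | hα
  · have h1 : Fintype.card α = 1 :=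
      le_antisymm (Fintype.card_le_one_iff_subsingleton.2 hα) Fintype.card_pos
    rw [Subsingleton.elim π 1, h1]
    simp
  · have hne : ∀ x, π x ≠ x := by
      intro x hx
      obtain ⟨y, hy⟩ := exists_ne x
      exact hy ((h x y).eq_of_left hx).symm
    have hc : π.IsCycle := by
      obtain ⟨x⟩ := ‹Nonempty α›
      exact ⟨x, hne x, fun y _ => h x y⟩
    have hs : π.support = Finset.univ := by
      ext x
      simp [hne x]
    rw [hc.cycleType, hs, Finset.card_univ]
    simp

theorem sum_prod_of_sameCycle [DecidableEq ι] [Nonempty α] {π : Equiv.Perm α}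
    (h : ∀ x y, π.SameCycle x y) :
    ∑ a : α → ι, ∏ i, A (a i) (a (π i)) = (A ^ Fintype.card α).trace := by
  obtain ⟨n, hn⟩ := Nat.exists_eq_succ_of_ne_zero (Fintype.card_ne_zero (α := α))
  let e : α ≃ Fin (n + 1) := Fintype.equivFinOfCardEq hn
  rw [hn, Nat.succ_eq_add_one, ← sum_prod_finRotate, ← sum_prod_permCongr A e]
  have hsc : ∀ x y, (e.permCongr π).SameCycle x y := by
    intro x y
    obtain ⟨k, hk⟩ := h (e.symm x) (e.symm y)
    refine ⟨k, ?_⟩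
    have : (e.permCongr π) ^ k = e.permCongr (π ^ k) := (map_zpow e.permCongrHom π k).symm
    rw [this, Equiv.permCongr_apply, hk, Equiv.apply_symm_apply]
  have hsc' : ∀ x y, (finRotate (n + 1)).SameCycle x y := by
    rcases n with _ | n
    -- On one point the rotation is the identity, which is not a cycle in the sense of `IsCycle`, so
    -- this case stands apart.
    · intro x y
      rw [Fin.fin_one_eq_zero x, Fin.fin_one_eq_zero y]
    · intro x y
      have hne : ∀ x, finRotate (n + 2) x ≠ x := fun x => by
        rw [← Equiv.Perm.mem_support, support_finRotate]
        exact Finset.mem_univ x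
      exact isCycle_finRotate.sameCycle (hne x) (hne y)
  have hconj : IsConj (e.permCongr π) (finRotate (n + 1)) := by
    rw [Equiv.Perm.partition_eq_of_isConj, Nat.Partition.ext_iff,
      Equiv.Perm.parts_partition_of_sameCycle hsc, Equiv.Perm.parts_partition_of_sameCycle hsc']
  obtain ⟨c, hc⟩ := isConj_iff.1 hconj
  rw [← sum_prod_permCongr A c, Equiv.permCongr_eq_mul, hc]

/-- Induction on the number of points, peeling off the cycle of a point `x`: the sum factors over
invariant subsets, and a single cycle is conjugate to a rotation. -/
theorem sum_prod_eq_prod_trace_pow [DecidableEq ι] (π : Equiv.Perm α) :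
    ∑ a : α → ι, ∏ i, A (a i) (a (π i)) =
      (π.partition.parts.map fun k => (A ^ k).trace).prod := by
  classical
  obtain ⟨n, h⟩ : ∃ n, Fintype.card α = n := ⟨_, rfl⟩
  induction n using Nat.strong_induction_on generalizing α with
  | _ n ih =>
    rcases isEmpty_or_nonempty α with hα | ⟨⟨x⟩⟩
    · rw [Subsingleton.elim π 1]
      simp [Equiv.Perm.parts_partition]
    · let p : α → Prop := fun y => π.SameCycle x y
      have hp : ∀ y, p (π y) ↔ p y := fun y => Equiv.Perm.sameCycle_apply_right
      have : Nonempty {y // p y} := ⟨⟨x, Equiv.Perm.SameCycle.refl _ _⟩⟩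
      have hs : ∀ y z, (π.subtypePerm hp).SameCycle y z := fun y z =>
        Equiv.Perm.sameCycle_subtypePerm.2 (y.2.symm.trans z.2)
      rw [sum_prod_subtypePerm A π p hp, π.parts_partition_subtypePerm p hp, Multiset.map_add,
        Multiset.prod_add, sum_prod_of_sameCycle A hs, Equiv.Perm.parts_partition_of_sameCycle hs,
        Multiset.map_singleton, Multiset.prod_singleton]
      congr 1
      refine ih (Fintype.card {y // ¬ p y}) ?_ _ rfl
      rw [← h]
      exact Fintype.card_subtype_lt (x := x) (not_not.2 (Equiv.Perm.SameCycle.refl _ _))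

end TraceSum

/-! ### The expectation of the product of traces -/

section Expectation

variable {lam : YoungDiagram} {l : ℕ}

theorem traceProduct_eq_sum (π : Equiv.Perm (Fin l)) (t : lam.cells → ℂ) :
    traceProduct lam π t = ∑ a : Fin l → Fin (diagramSize lam), ∑ b : Fin l → Fin (diagramSize lam),
      ∏ i, bandMatrix lam t (a i) (b i) *
        (starRingEnd ℂ) (bandMatrix lam t (a (π⁻¹ i)) (b i)) := by
  -- Passing to the inverse leaves the cycle lengths unchanged and makes the indices agree with
  -- those of the character formula.
  have hpart : π.partition = π⁻¹.partition :=
    Equiv.Perm.partition_eq_of_isConj.1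
      (Equiv.Perm.isConj_iff_cycleType_eq.2 (Equiv.Perm.cycleType_inv π).symm)
  rw [traceProduct, hpart, ← sum_prod_eq_prod_trace_pow]
  refine Finset.sum_congr rfl fun a _ => ?_
  simp only [Matrix.mul_apply, Matrix.conjTranspose_apply]
  rw [Finset.prod_univ_sum, Fintype.piFinset_univ]
  rfl

theorem YoungDiagram.fst_lt_diagramSize (x : lam.cells) : x.1.1 < diagramSize lam :=
  lt_of_lt_of_le (YoungDiagram.mem_iff_lt_colLen.1 (lam.up_left_mem le_rfl (Nat.zero_le _)
    ((YoungDiagram.mem_cells x.1).1 x.2))) (le_max_right _ _)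

theorem YoungDiagram.snd_lt_diagramSize (x : lam.cells) : x.1.2 < diagramSize lam :=
  lt_of_lt_of_le (YoungDiagram.mem_iff_lt_rowLen.1 (lam.up_left_mem (Nat.zero_le _) le_rfl
    ((YoungDiagram.mem_cells x.1).1 x.2))) (le_max_left _ _)

/-- The entry of `T_lam` at a place of the plane, which vanishes outside of `lam`. -/
def extendEntry (lam : YoungDiagram) (t : lam.cells → ℂ) (x : ℕ × ℕ) : ℂ :=
  if h : x ∈ lam.cells then t ⟨x, h⟩ else 0

/-- Only index pairs for which every unconjugated entry sits at a box contribute, and these are the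
fillings. The conjugated entries may still fall outside `lam`, hence `extendEntry`. -/
theorem traceProduct_eq_sum_fillings (π : Equiv.Perm (Fin l)) (t : lam.cells → ℂ) :
    traceProduct lam π t = ∑ f : Fin l → lam.cells,
      ∏ i, t (f i) * (starRingEnd ℂ) (extendEntry lam t ((f i).1.1, (f (π⁻¹ i)).1.2)) := by
  rw [traceProduct_eq_sum, ← Fintype.sum_prod_type']
  symm
  refine Finset.sum_of_injOn (fun f : Fin l → lam.cells =>
    ((fun i => ⟨(f i).1.2, YoungDiagram.snd_lt_diagramSize _⟩),
      fun i => ⟨(f i).1.1, YoungDiagram.fst_lt_diagramSize _⟩)) ?_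
    (fun _ _ => Finset.mem_coe.2 (Finset.mem_univ _)) ?_ ?_
  · intro f _ g _ h
    funext i
    have h1 := congrFun (Prod.mk.inj h).1 i
    have h2 := congrFun (Prod.mk.inj h).2 i
    exact YoungDiagram.cells_ext (Fin.mk.inj h2) (Fin.mk.inj h1)
  · rintro ⟨a, b⟩ _ hab
    have : ∃ i, ((b i : ℕ), (a i : ℕ)) ∉ lam.cells := by
      by_contra! hc
      exact hab ⟨fun i => ⟨((b i : ℕ), (a i : ℕ)), hc i⟩, Finset.mem_coe.2 (Finset.mem_univ _), rfl⟩
    obtain ⟨i, hi⟩ := this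
    refine Finset.prod_eq_zero (Finset.mem_univ i) ?_
    simp only [bandMatrix, Matrix.of_apply]
    rw [dif_neg hi, zero_mul]
  · intro f _
    refine Finset.prod_congr rfl fun i _ => ?_
    simp only [bandMatrix, Matrix.of_apply, extendEntry]
    rw [dif_pos (f i).2]

open Classical in
-- The pairings in Wick's formula are the permutations `σ⁻¹ * ρ`: equality of rows is the row
-- condition for `σ⁻¹ * ρ`, and equality of columns, reindexed, is the column condition for `σ`. If
-- a conjugated entry lies outside `lam`, both sides vanish.
theorem integral_filling (ρ : Equiv.Perm (Fin l)) (f : Fin l → lam.cells) :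
    Integrable (fun t => ∏ i, t (f i) *
        (starRingEnd ℂ) (extendEntry lam t ((f i).1.1, (f (ρ i)).1.2))) (entryLaw lam) ∧
      ∫ t, ∏ i, t (f i) * (starRingEnd ℂ) (extendEntry lam t ((f i).1.1, (f (ρ i)).1.2))
          ∂(entryLaw lam) =
        Fintype.card {σ : Equiv.Perm (Fin l) // IsCompatible σ (σ⁻¹ * ρ) f} := by
  have hcard : Fintype.card {σ : Equiv.Perm (Fin l) // IsCompatible σ (σ⁻¹ * ρ) f} =
      Fintype.card {σ : Equiv.Perm (Fin l) //
        ∀ i, (f (σ i)).1 = ((f i).1.1, (f (ρ i)).1.2)} := by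
    refine Fintype.card_congr (((Equiv.inv _).trans (Equiv.mulRight ρ)).subtypeEquiv fun σ => ?_)
    simp only [IsCompatible, Prod.ext_iff, Equiv.trans_apply, Equiv.inv_apply, Equiv.coe_mulRight,
      forall_and]
    rw [and_comm]
    refine and_congr_right fun _ => ?_
    rw [← (σ⁻¹ * ρ).forall_congr_right]
    have hσ : ∀ x, σ (σ⁻¹ x) = x := σ.apply_symm_apply
    simp only [Equiv.Perm.mul_apply, hσ, eq_comm]
  by_cases h : ∀ i, ((f i).1.1, (f (ρ i)).1.2) ∈ lam.cells
  · have heq : ∀ t : lam.cells → ℂ, ∀ i, extendEntry lam t ((f i).1.1, (f (ρ i)).1.2) =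
        t ⟨((f i).1.1, (f (ρ i)).1.2), h i⟩ := fun t i => dif_pos (h i)
    simp only [heq]
    refine ⟨integrable_prod_mul_conj f fun i => ⟨((f i).1.1, (f (ρ i)).1.2), h i⟩, ?_⟩
    rw [entryLaw, integral_prod_mul_conj f fun i => ⟨((f i).1.1, (f (ρ i)).1.2), h i⟩, hcard]
    congr 1
    refine Fintype.card_congr (Equiv.subtypeEquivRight fun σ => ?_)
    simp only [funext_iff, Function.comp_apply, Subtype.ext_iff]
  · push Not at h
    obtain ⟨i, hi⟩ := h
    have hz : ∀ t : lam.cells → ℂ, ∏ i, t (f i) *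
        (starRingEnd ℂ) (extendEntry lam t ((f i).1.1, (f (ρ i)).1.2)) = 0 := by
      intro t
      refine Finset.prod_eq_zero (Finset.mem_univ i) ?_
      rw [extendEntry, dif_neg hi, map_zero, mul_zero]
    simp only [hz]
    refine ⟨integrable_zero _ _ _, ?_⟩
    rw [integral_zero, hcard, eq_comm, Nat.cast_eq_zero, Fintype.card_eq_zero_iff]
    exact ⟨fun σ => hi (σ.2 i ▸ (f (σ.1 i)).2)⟩

theorem integrable_traceProduct (π : Equiv.Perm (Fin l)) :
    Integrable (traceProduct lam π) (entryLaw lam) := by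
  have : traceProduct lam π = fun t => ∑ f : Fin l → lam.cells,
      ∏ i, t (f i) * (starRingEnd ℂ) (extendEntry lam t ((f i).1.1, (f (π⁻¹ i)).1.2)) :=
    funext fun t => traceProduct_eq_sum_fillings π t
  rw [this]
  exact integrable_finsetSum _ fun f _ => (integral_filling π⁻¹ f).1

open Classical in
theorem integral_traceProduct (π : Equiv.Perm (Fin l)) :
    ∫ t, traceProduct lam π t ∂(entryLaw lam) = ∑ σ : Equiv.Perm (Fin l),
      (Fintype.card {f : Fin l → lam.cells // IsCompatible σ (σ⁻¹ * π⁻¹) f} : ℂ) := by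
  simp_rw [traceProduct_eq_sum_fillings]
  rw [integral_finsetSum _ fun f _ => (integral_filling π⁻¹ f).1]
  simp_rw [(integral_filling π⁻¹ _).2, Fintype.card_subtype, Finset.card_filter]
  push_cast
  exact Finset.sum_comm

end Expectation

/-! ### Functions which are constant on the cycles of a permutation -/

section Cycles

/-- The cycles of a permutation, fixed points included. -/
abbrev Equiv.Perm.Cycles {α : Type*} (σ : Equiv.Perm α) : Type _ :=
  Quotient (Equiv.Perm.SameCycle.setoid σ)

instance {α : Type*} [Finite α] (σ : Equiv.Perm α) : Fintype σ.Cycles := Fintype.ofFinite _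

variable {α X : Type*} {σ : Equiv.Perm α}

/-- The cycle which contains a point. -/
def Equiv.Perm.cycleMk (σ : Equiv.Perm α) (i : α) : σ.Cycles := Quotient.mk _ i

theorem Equiv.Perm.cycleMk_apply (i : α) : σ.cycleMk (σ i) = σ.cycleMk i :=
  Quotient.sound (Equiv.Perm.sameCycle_apply_left.2 (Equiv.Perm.SameCycle.refl σ i))

theorem Equiv.Perm.cycleMk_surjective : Function.Surjective σ.cycleMk := Quotient.mk_surjective

theorem Equiv.Perm.eq_of_sameCycle {f : α → X} (hf : ∀ i, f (σ i) = f i) {i j : α}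
    (h : σ.SameCycle i j) : f i = f j := by
  obtain ⟨n, rfl⟩ := h
  have hinv : ∀ i, f (σ⁻¹ i) = f i := fun i => by
    rw [← hf, ← Equiv.Perm.mul_apply, mul_inv_cancel, Equiv.Perm.one_apply]
  induction n using Int.induction_on with
  | zero => simp
  | succ n ih => rw [ih, add_comm, _root_.zpow_one_add, Equiv.Perm.mul_apply, hf]
  | pred n ih => rw [ih, sub_eq_neg_add, _root_.zpow_add, _root_.zpow_neg_one, Equiv.Perm.mul_apply, hinv]

theorem Equiv.Perm.exists_comp_cycleMk {f : α → X} (hf : ∀ i, f (σ i) = f i) :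
    ∃ g : σ.Cycles → X, ∀ i, g (σ.cycleMk i) = f i :=
  ⟨Quotient.lift f fun _ _ h => Equiv.Perm.eq_of_sameCycle hf h, fun _ => rfl⟩

/-- The trace identity for the `2 × 2` identity matrix counts two-colourings constant on cycles: `2
^ #cycles` on one side, a factor `2` for each part on the other. -/
theorem Equiv.Perm.card_cycles [Fintype α] [DecidableEq α] (σ : Equiv.Perm α) :
    Fintype.card σ.Cycles = Multiset.card σ.partition.parts := by
  classical
  have h := sum_prod_eq_prod_trace_pow (1 : Matrix (Fin 2) (Fin 2) ℂ) σ
  have h1 : ∑ a : α → Fin 2, ∏ i, (1 : Matrix (Fin 2) (Fin 2) ℂ) (a i) (a (σ i)) =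
      (2 : ℂ) ^ Fintype.card σ.Cycles := by
    have h2 : ∀ a : α → Fin 2, ∏ i, (1 : Matrix (Fin 2) (Fin 2) ℂ) (a i) (a (σ i)) =
        if ∀ i, a (σ i) = a i then 1 else 0 := by
      intro a
      split_ifs with ha
      · exact Finset.prod_eq_one fun i _ => by rw [ha, Matrix.one_apply_eq]
      · push Not at ha
        obtain ⟨i, hi⟩ := ha
        exact Finset.prod_eq_zero (Finset.mem_univ i) (Matrix.one_apply_ne hi.symm)
    simp_rw [h2]
    rw [Finset.sum_boole]
    have h3 : (Finset.univ.filter fun a : α → Fin 2 => ∀ i, a (σ i) = a i).card =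
        Fintype.card (σ.Cycles → Fin 2) := by
      rw [← Finset.card_univ]
      symm
      refine Finset.card_bij (fun g _ => g ∘ σ.cycleMk) ?_ ?_ ?_
      · intro g _
        simp [Equiv.Perm.cycleMk_apply]
      · intro g _ g' _ h
        exact Equiv.Perm.cycleMk_surjective.injective_comp_right h
      · intro a ha
        obtain ⟨g, hg⟩ := Equiv.Perm.exists_comp_cycleMk (Finset.mem_filter.1 ha).2
        exact ⟨g, Finset.mem_univ g, funext hg⟩
    rw [h3]
    simp
  rw [h1] at h
  simp only [one_pow, Matrix.trace_one, Fintype.card_fin, Multiset.map_const',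
    Multiset.prod_replicate] at h
  exact Nat.pow_right_injective le_rfl (by exact_mod_cast h)

theorem Equiv.Perm.neg_one_pow_card_cycles {l : ℕ} (σ : Equiv.Perm (Fin l)) :
    (-1 : ℂ) ^ l * (-1) ^ Fintype.card σ.Cycles = ((Equiv.Perm.sign σ : ℤ) : ℂ) := by
  have hle := σ.sum_cycleType_le
  rw [Fintype.card_fin] at hle
  obtain ⟨k, hk⟩ := Nat.exists_eq_add_of_le hle
  rw [Equiv.Perm.card_cycles, Equiv.Perm.parts_partition, Multiset.card_add,
    Multiset.card_replicate, Equiv.Perm.sign_of_cycleType, Fintype.card_fin,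
    ← Equiv.Perm.sum_cycleType]
  have h1 : l - σ.cycleType.sum = k := by omega
  have h2 : (-1 : ℂ) ^ k * (-1) ^ k = 1 := by rw [← mul_pow]; simp
  have h3 : (-1 : ℂ) ^ l = (-1) ^ σ.cycleType.sum * (-1) ^ k := by rw [← pow_add, ← hk]
  rw [h1, h3]
  push_cast
  rw [pow_add, pow_add]
  linear_combination (-1 : ℂ) ^ σ.cycleType.sum * (-1) ^ Multiset.card σ.cycleType * h2

end Cycles

/-! ### Boxes of multirectangular diagrams -/

section Multirect

variable {m : ℕ}

/-- The list of the blocks which contain the rows of a multirectangular diagram. -/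
def blockList (p : Fin m → ℕ) : List (Fin m) := (List.ofFn fun i => List.replicate (p i) i).flatten

theorem multirectList_eq_map (p q : Fin m → ℕ) : multirectList p q = (blockList p).map q := by
  rw [multirectList, blockList, List.map_flatten, List.map_ofFn]
  congr 2
  funext i
  simp

theorem card_blockList_eq (p : Fin m → ℕ) (i : Fin m) :
    (Finset.univ.filter fun r : Fin (blockList p).length => (blockList p).get r = i).card = p i := by
  have h : (blockList p).count i = p i := by
    rw [blockList, List.count_flatten, List.map_ofFn, List.sum_ofFn]
    simp [List.count_replicate]
  rw [← h, ← Multiset.coe_count]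
  conv_rhs => rw [← List.ofFn_get (blockList p), ← Fin.univ_val_map, Multiset.count_map]
  simp only [eq_comm]
  rfl

theorem mem_multirect {p q : Fin m → ℕ} {hq : Antitone q} {x : ℕ × ℕ} :
    x ∈ (multirect p q hq).cells ↔
      ∃ h : x.1 < (blockList p).length, x.2 < q ((blockList p).get ⟨x.1, h⟩) := by
  rw [YoungDiagram.mem_cells, multirect, YoungDiagram.mem_ofRowLens]
  simp only [multirectList_eq_map, List.length_map, List.getElem_map, List.get_eq_getElem]

/-- The largest value of `g` on a cycle. -/
def cycleSup {α : Type*} [Fintype α] {σ : Equiv.Perm α} (g : α → Fin m) (d : σ.Cycles) : Fin m :=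
  open Classical in
  (Finset.univ.filter fun i => σ.cycleMk i = d).sup'
    (by
      obtain ⟨i, hi⟩ := Equiv.Perm.cycleMk_surjective d
      exact ⟨i, by simp [hi]⟩) g

/-- A column shared by a whole cycle must meet the shortest of its rows; as `q` decreases, that row
lies in the block of largest index. -/
theorem lt_cycleSup_iff {α : Type*} [Fintype α] {σ : Equiv.Perm α} (g : α → Fin m) (d : σ.Cycles)
    {q : Fin m → ℕ} (hq : Antitone q) (n : ℕ) :
    n < q (cycleSup g d) ↔ ∀ i, σ.cycleMk i = d → n < q (g i) := by
  classical
  refine ⟨fun h i hi => lt_of_lt_of_le h (hq ?_), fun h => ?_⟩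
  · exact Finset.le_sup' g (by simp [hi])
  · obtain ⟨i, hi, hs⟩ := Finset.exists_mem_eq_sup' (s := Finset.univ.filter
      fun i => σ.cycleMk i = d) (by
      obtain ⟨i, hi⟩ := Equiv.Perm.cycleMk_surjective d
      exact ⟨i, by simp [hi]⟩) g
    have : cycleSup g d = g i := by
      rw [← hs, cycleSup]
    rw [this]
    exact h i (Finset.mem_filter.1 hi).2

variable {α : Type*} [Fintype α]

open Classical in
-- Once each cycle of `τ` has its row, the cycles of `σ` choose their columns independently.
theorem card_isCompatible_eq_sum_rows [DecidableEq α] (σ τ : Equiv.Perm α) (p q : Fin m → ℕ) (hq : Antitone q) :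
    Fintype.card {f : α → (multirect p q hq).cells // IsCompatible σ τ f} =
      ∑ a : τ.Cycles → Fin (blockList p).length,
        ∏ d : σ.Cycles, q (cycleSup (fun i => (blockList p).get (a (τ.cycleMk i))) d) := by
  have hc : ∀ a : τ.Cycles → Fin (blockList p).length,
      ∏ d : σ.Cycles, q (cycleSup (fun i => (blockList p).get (a (τ.cycleMk i))) d) =
        Fintype.card ((d : σ.Cycles) →
          Fin (q (cycleSup (fun i => (blockList p).get (a (τ.cycleMk i))) d))) := by
    intro a
    rw [Fintype.card_pi]
    simp
  simp_rw [hc]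
  rw [← Fintype.card_sigma]
  symm
  let F : (Σ a : τ.Cycles → Fin (blockList p).length, (d : σ.Cycles) →
      Fin (q (cycleSup (fun i => (blockList p).get (a (τ.cycleMk i))) d))) →
      {f : α → (multirect p q hq).cells // IsCompatible σ τ f} := fun x =>
    ⟨fun i => ⟨((x.1 (τ.cycleMk i) : ℕ), (x.2 (σ.cycleMk i) : ℕ)), mem_multirect.2
      ⟨(x.1 (τ.cycleMk i)).2,
        (lt_cycleSup_iff _ _ hq _).1 (x.2 (σ.cycleMk i)).2 i rfl⟩⟩,
      fun i => congrArg (fun d => (x.2 d : ℕ)) (Equiv.Perm.cycleMk_apply i),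
      fun i => congrArg (fun c => (x.1 c : ℕ)) (Equiv.Perm.cycleMk_apply i)⟩
  refine Fintype.card_of_bijective (f := F) ⟨?_, ?_⟩
  · rintro ⟨a, b⟩ ⟨a', b'⟩ h
    have hval : ∀ i, (((a (τ.cycleMk i) : ℕ), (b (σ.cycleMk i) : ℕ)) : ℕ × ℕ) =
        ((a' (τ.cycleMk i) : ℕ), (b' (σ.cycleMk i) : ℕ)) := fun i =>
      congrArg Subtype.val (congrFun (congrArg Subtype.val h) i)
    have ha : a = a' := by
      funext c
      obtain ⟨i, rfl⟩ := Equiv.Perm.cycleMk_surjective c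
      exact Fin.ext (Prod.mk.inj (hval i)).1
    subst ha
    congr 1
    funext d
    obtain ⟨i, rfl⟩ := Equiv.Perm.cycleMk_surjective d
    exact Fin.ext (Prod.mk.inj (hval i)).2
  · rintro ⟨f, hf⟩
    have hmem := fun i => mem_multirect.1 (f i).2
    choose h1 h2 using hmem
    obtain ⟨a, ha⟩ := Equiv.Perm.exists_comp_cycleMk (σ := τ)
      (f := fun i => (⟨(f i).1.1, h1 i⟩ : Fin (blockList p).length))
      fun i => Fin.ext (hf.2 i)
    obtain ⟨b, hb⟩ := Equiv.Perm.exists_comp_cycleMk (σ := σ) (f := fun i => (f i).1.2) hf.1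
    have hbd : ∀ d, b d < q (cycleSup (fun i => (blockList p).get (a (τ.cycleMk i))) d) := by
      intro d
      rw [lt_cycleSup_iff _ _ hq]
      rintro i rfl
      rw [hb, ha]
      exact h2 i
    refine ⟨⟨a, fun d => ⟨b d, hbd d⟩⟩, Subtype.ext (funext fun i => YoungDiagram.cells_ext ?_ ?_)⟩
    · change ((a (τ.cycleMk i) : ℕ)) = _
      rw [ha]
    · exact hb i

/-- Grouping rows by block: a choice `g` of blocks is refined by `∏ c, p (g c)` choices of rows. -/
theorem sum_comp_get_blockList {C : Type*} [Fintype C] [DecidableEq C] (p : Fin m → ℕ)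
    (F : (C → Fin m) → ℕ) :
    ∑ a : C → Fin (blockList p).length, F (fun c => (blockList p).get (a c)) =
      ∑ g : C → Fin m, (∏ c, p (g c)) * F g := by
  rw [← Finset.sum_fiberwise Finset.univ fun a : C → Fin (blockList p).length =>
    fun c => (blockList p).get (a c)]
  refine Finset.sum_congr rfl fun g _ => ?_
  rw [Finset.sum_congr rfl fun a ha => by rw [(Finset.mem_filter.1 ha).2], Finset.sum_const,
    smul_eq_mul]
  congr 1
  simp_rw [← card_blockList_eq p]
  rw [← Fintype.card_piFinset]
  congr 1
  ext a
  simp [funext_iff]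

open Classical in
theorem card_isCompatible [DecidableEq α] (σ τ : Equiv.Perm α) (p q : Fin m → ℕ) (hq : Antitone q) :
    Fintype.card {f : α → (multirect p q hq).cells // IsCompatible σ τ f} =
      ∑ g : τ.Cycles → Fin m,
        (∏ c, p (g c)) * ∏ d : σ.Cycles, q (cycleSup (fun i => g (τ.cycleMk i)) d) := by
  rw [card_isCompatible_eq_sum_rows]
  exact sum_comp_get_blockList p fun g : τ.Cycles → Fin m =>
    ∏ d : σ.Cycles, q (cycleSup (fun i => g (τ.cycleMk i)) d)

end Multirect

/-! ### The polynomials -/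

section Polynomial

variable {m : ℕ} {α : Type*} [Fintype α]

open Classical in
variable (m) in
/-- The polynomial which counts the maps to the boxes of `p × q` compatible with `σ` and `τ`. -/
def fillingPolynomial (σ τ : Equiv.Perm α) : MvPolynomial (Fin m ⊕ Fin m) ℂ :=
  ∑ g : τ.Cycles → Fin m, (∏ c, MvPolynomial.X (Sum.inl (g c))) *
    ∏ d : σ.Cycles, MvPolynomial.X (Sum.inr (cycleSup (fun i => g (τ.cycleMk i)) d))

open Classical in
theorem eval_fillingPolynomial (σ τ : Equiv.Perm α) (P Q : Fin m → ℂ) :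
    MvPolynomial.eval (Sum.elim P Q) (fillingPolynomial m σ τ) =
      ∑ g : τ.Cycles → Fin m,
        (∏ c, P (g c)) * ∏ d : σ.Cycles, Q (cycleSup (fun i => g (τ.cycleMk i)) d) := by
  simp [fillingPolynomial]

open Classical in
theorem eval_fillingPolynomial_multirect [DecidableEq α] (σ τ : Equiv.Perm α) (p q : Fin m → ℕ) (hq : Antitone q) :
    MvPolynomial.eval (Sum.elim (fun i => (p i : ℂ)) (fun i => (q i : ℂ)))
        (fillingPolynomial m σ τ) =
      Fintype.card {f : α → (multirect p q hq).cells // IsCompatible σ τ f} := by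
  rw [eval_fillingPolynomial, card_isCompatible]
  push_cast
  rfl

theorem eval_fillingPolynomial_neg (σ τ : Equiv.Perm α) (P Q : Fin m → ℂ) :
    MvPolynomial.eval (Sum.elim P (-Q)) (fillingPolynomial m σ τ) =
      (-1) ^ Fintype.card σ.Cycles *
        MvPolynomial.eval (Sum.elim P Q) (fillingPolynomial m σ τ) := by
  classical
  rw [eval_fillingPolynomial, eval_fillingPolynomial, Finset.mul_sum]
  refine Finset.sum_congr rfl fun g _ => ?_
  simp only [Pi.neg_apply]
  rw [Finset.prod_neg, Finset.card_univ]
  ring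

variable {l : ℕ}

variable (m) in
/-- The polynomial of the normalized character. -/
def characterPolynomial (π : Equiv.Perm (Fin l)) : MvPolynomial (Fin m ⊕ Fin m) ℂ :=
  ∑ σ : Equiv.Perm (Fin l), MvPolynomial.C ((Equiv.Perm.sign σ : ℤ) : ℂ) *
    fillingPolynomial m σ (σ⁻¹ * π⁻¹)

variable (m) in
/-- The polynomial of the moments of the Gaussian random matrix. -/
def momentPolynomial (π : Equiv.Perm (Fin l)) : MvPolynomial (Fin m ⊕ Fin m) ℂ :=
  ∑ σ : Equiv.Perm (Fin l), fillingPolynomial m σ (σ⁻¹ * π⁻¹)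

theorem isCharacterPolynomial_characterPolynomial (π : Equiv.Perm (Fin l)) :
    IsCharacterPolynomial π (characterPolynomial m π) := by
  classical
  intro p q hq _ _
  rw [normalizedCharacter_eq_sum, characterPolynomial, map_sum]
  refine Finset.sum_congr rfl fun σ _ => ?_
  rw [map_mul, MvPolynomial.eval_C, eval_fillingPolynomial_multirect σ _ p q hq]

theorem isMomentPolynomial_momentPolynomial (π : Equiv.Perm (Fin l)) :
    IsMomentPolynomial π (momentPolynomial m π) := by
  classical
  intro p q hq _ _
  refine ⟨integrable_traceProduct π, ?_⟩
  rw [integral_traceProduct, momentPolynomial, map_sum]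
  exact Finset.sum_congr rfl fun σ _ => eval_fillingPolynomial_multirect σ _ p q hq

theorem eval_characterPolynomial (π : Equiv.Perm (Fin l)) (P Q : Fin m → ℂ) :
    MvPolynomial.eval (Sum.elim P Q) (characterPolynomial m π) =
      (-1) ^ l * MvPolynomial.eval (Sum.elim P (-Q)) (momentPolynomial m π) := by
  rw [characterPolynomial, momentPolynomial, map_sum, map_sum, Finset.mul_sum]
  refine Finset.sum_congr rfl fun σ _ => ?_
  rw [map_mul, MvPolynomial.eval_C, eval_fillingPolynomial_neg, ← mul_assoc,
    Equiv.Perm.neg_one_pow_card_cycles]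

end Polynomial

/-! ### Uniqueness -/

section Uniqueness

variable {m : ℕ}

theorem exists_tail_sums_eq (Q : Fin m → ℂ) :
    ∃ u : Fin m → ℂ, ∀ i, ∑ j, (if i ≤ j then u j else 0) = Q i := by
  -- The value `0` at `m` ends the telescoping sum, so that the successive differences of `Q` have
  -- tail sums exactly `Q`.
  let R : ℕ → ℂ := fun n => if h : n < m then Q ⟨n, h⟩ else 0
  refine ⟨fun j => R j - R (j + 1), fun i => ?_⟩
  have key : ∀ n, ∑ j ∈ Finset.range n, (if (i : ℕ) ≤ j then R j - R (j + 1) else 0) =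
      if (i : ℕ) ≤ n then R i - R n else 0 := by
    intro n
    induction n with
    | zero =>
      split_ifs with h
      · simp [Nat.le_zero.1 h]
      · simp
    | succ n ih =>
      rw [Finset.sum_range_succ, ih]
      rcases lt_trichotomy (i : ℕ) (n + 1) with h | h | h
      · rw [if_pos (by omega), if_pos (by omega), if_pos (by omega)]
        ring
      · rw [if_neg (by omega), if_neg (by omega), if_pos (by omega), h]
        ring
      · rw [if_neg (by omega), if_neg (by omega), if_neg (by omega)]
        ring
  have h := key m
  rw [← Fin.sum_univ_eq_sum_range fun j => if (i : ℕ) ≤ j then R j - R (j + 1) else 0,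
    if_pos i.2.le] at h
  have h1 : R m = 0 := dif_neg (lt_irrefl m)
  have h2 : R i = Q i := dif_pos i.2
  rw [h1, h2, sub_zero] at h
  exact h

/-- A polynomial in the row multiplicities and the row lengths is determined by its values at
multirectangular Young diagrams. -/
theorem MvPolynomial.eq_of_eval_multirect {S S' : MvPolynomial (Fin m ⊕ Fin m) ℂ}
    (h : ∀ p q : Fin m → ℕ, Antitone q → (∀ i, 0 < p i) → (∀ i, 0 < q i) →
      MvPolynomial.eval (Sum.elim (fun i => (p i : ℂ)) (fun i => (q i : ℂ))) S =
        MvPolynomial.eval (Sum.elim (fun i => (p i : ℂ)) (fun i => (q i : ℂ))) S') :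
    S = S' := by
  -- Writing each `q i` as a tail sum of new variables turns the constraint of being decreasing into
  -- freely chosen positive integers, a product of infinite sets, on which a polynomial is
  -- determined.
  let w : Fin m ⊕ Fin m → MvPolynomial (Fin m ⊕ Fin m) ℂ :=
    Sum.elim (fun i => MvPolynomial.X (Sum.inl i))
      (fun i => ∑ j, if i ≤ j then MvPolynomial.X (Sum.inr j) else 0)
  have hw : ∀ (v : Fin m ⊕ Fin m → ℂ) (T : MvPolynomial (Fin m ⊕ Fin m) ℂ),
      MvPolynomial.eval v (MvPolynomial.bind₁ w T) =
        MvPolynomial.eval (Sum.elim (fun i => v (Sum.inl i))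
          fun i => ∑ j, if i ≤ j then v (Sum.inr j) else 0) T := by
    intro v T
    rw [MvPolynomial.eval, MvPolynomial.eval₂Hom_bind₁]
    change MvPolynomial.eval _ T = MvPolynomial.eval _ T
    congr 2
    funext x
    rcases x with i | i
    · simp [w]
    · simp only [w, Sum.elim_inr, map_sum]
      refine Finset.sum_congr rfl fun j _ => ?_
      split_ifs <;> simp
  have hbind : MvPolynomial.bind₁ w S = MvPolynomial.bind₁ w S' := by
    refine MvPolynomial.funext_set (fun _ => Set.range fun n : ℕ => ((n + 1 : ℕ) : ℂ))
      (fun _ => Set.infinite_range_of_injective fun a b hab => by simpa using hab) fun v hv => ?_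
    have hv' : ∀ x, ∃ n : ℕ, ((n + 1 : ℕ) : ℂ) = v x := fun x => hv x (Set.mem_univ x)
    choose n hn using hv'
    rw [hw, hw]
    have := h (fun i => n (Sum.inl i) + 1) (fun i => ∑ j, if i ≤ j then n (Sum.inr j) + 1 else 0)
      ?_ (fun i => Nat.succ_pos _) ?_
    · have e : (Sum.elim (fun i => v (Sum.inl i)) fun i => ∑ j, if i ≤ j then v (Sum.inr j) else 0) =
          Sum.elim (fun i => ((n (Sum.inl i) + 1 : ℕ) : ℂ)) (fun i =>
            ((∑ j, if i ≤ j then n (Sum.inr j) + 1 else 0 : ℕ) : ℂ)) := by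
        push_cast at hn
        push_cast
        simp only [hn]
      rw [e]
      exact this
    · intro i i' hi
      refine Finset.sum_le_sum fun j _ => ?_
      split_ifs with h1 h2
      · exact le_rfl
      · exact absurd (hi.trans h1) h2
      · exact Nat.zero_le _
      · exact le_rfl
    · intro i
      refine Finset.sum_pos' (fun j _ => Nat.zero_le _) ⟨i, Finset.mem_univ i, ?_⟩
      simp
  -- The substitution is onto on complex points, so equality after substitution gives equality
  -- before it.
  refine MvPolynomial.funext fun v => ?_
  obtain ⟨u, hu⟩ := exists_tail_sums_eq fun i => v (Sum.inr i)
  have hv : v = Sum.elim (fun i => v (Sum.inl i)) fun i => ∑ j, if i ≤ j then u j else 0 := by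
    funext x
    rcases x with i | i
    · rfl
    · exact (hu i).symm
  have h' := congrArg (MvPolynomial.eval (Sum.elim (fun i => v (Sum.inl i)) u)) hbind
  rw [hw, hw] at h'
  rw [hv]
  exact h'

theorem IsCharacterPolynomial.unique {l : ℕ} {π : Equiv.Perm (Fin l)}
    {S S' : MvPolynomial (Fin m ⊕ Fin m) ℂ} (h : IsCharacterPolynomial π S)
    (h' : IsCharacterPolynomial π S') : S = S' :=
  MvPolynomial.eq_of_eval_multirect fun p q hq h1 h2 =>
    (h p q hq h1 h2).trans (h' p q hq h1 h2).symm

theorem IsMomentPolynomial.unique {l : ℕ} {π : Equiv.Perm (Fin l)}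
    {M M' : MvPolynomial (Fin m ⊕ Fin m) ℂ} (h : IsMomentPolynomial π M)
    (h' : IsMomentPolynomial π M') : M = M' :=
  MvPolynomial.eq_of_eval_multirect fun p q hq h1 h2 =>
    (h p q hq h1 h2).2.trans (h' p q hq h1 h2).2.symm

end Uniqueness

end

theorem mainTheorem10 (m l : ℕ) (π : Equiv.Perm (Fin l)) :
    (∃! S : MvPolynomial (Fin m ⊕ Fin m) ℂ, IsCharacterPolynomial π S) ∧
    (∃! M : MvPolynomial (Fin m ⊕ Fin m) ℂ, IsMomentPolynomial π M) ∧
    ∀ S M : MvPolynomial (Fin m ⊕ Fin m) ℂ,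
      IsCharacterPolynomial π S → IsMomentPolynomial π M →
      ∀ p q : Fin m → ℂ,
        MvPolynomial.eval (Sum.elim p q) S =
          (-1) ^ l * MvPolynomial.eval (Sum.elim p (-q)) M := by
  have hS := isCharacterPolynomial_characterPolynomial (m := m) π
  have hM := isMomentPolynomial_momentPolynomial (m := m) π
  refine ⟨⟨_, hS, fun S h => h.unique hS⟩, ⟨_, hM, fun M h => h.unique hM⟩,
    fun S M h h' p q => ?_⟩
  rw [h.unique hS, h'.unique hM, eval_characterPolynomial]
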